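/- **Setting.** Let $E\subseteq\mathbb R^d$ be contained in the closure of its interior and let $F$ be a compact metric space; $\mathcal P(F)$ is the space of Borel probability measures with the weak topology. A function on $E$ is of class $C^k$ if it is the restriction of a $C^k$ function on an open neighbourhood of $E$ (its gradient on $E$ is then determined by its values on $E$; $C^1(E^2)$ is defined likewise), and $C_{cc}^\infty(E)$ is the set of smooth functions on $E$ that are constant outside a compact subset of $E$. Let $V_{x,p}\in C(F)$ for $x\in E$, $p\in\mathbb R^d$. Let $\mathcal D$ be a linear subspace of $C(F)$ and, for $x\in E$, let $A_x:\mathcal D\to C(F)$ be a linear operator (the limiting fast generator $A_x^{\mathrm{fast}}$) such that $x\mapsto A_xg\in C(F)$ is continuous for each $g\in\mathcal D$. Put $$\mathcal I(x,\pi)=-\inf_{g\in\mathcal D,\ \inf g>0}\int\frac{A_xg}{g}\,d\pi,\qquad \Lambda(x,p,\pi)=\int V_{x,p}\,d\pi,\qquad \mathcal H(x,p)=\sup_{\pi\in\mathcal P(F)}\{\Lambda(x,p,\pi)-\mathcal I(x,\pi)\}.$$ **Principal eigenvalue problem.** (1) If $g\in\mathcal D$, $g>0$ and $\varepsilon\in(0,1)$,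 then $g^{1-\varepsilon}\in\mathcal D$. (2) For all $x\in E$, $p\in\mathbb R^d$ and $\delta>0$ there is a strictly positive $g\in\mathcal D$ with $|(V_{x,p}(z)+A_x)g(z)-\mathcal H(x,p)g(z)|\le\delta g(z)$ for all $z\in F$. **Regularity of $V$.** (V1) $(x,p)\mapsto V_{x,p}\in C(F)$ is continuous. (V2) $p\mapsto V_{x,p}(z)$ is convex and $V_{x,0}(z)=0$. (V3) There is $\Upsilon:E\to[0,\infty)$ of class $C^1$ with compact sublevel sets and $\sup_{x,z}V_{x,\nabla\Upsilon(x)}(z)<\infty$. (V4) For every compact $K\subseteq E$ there are $M,C_1,C_2\ge0$ with $V_{x,p}(z_1)\le\max\{M,C_1V_{x,p}(z_2)+C_2\}$ for all $x\in K$, $p\in\mathbb R^d$, $z_1,z_2\in F$. (V5) $\Lambda$ satisfies the continuity estimate for some $\Psi:E^2\to[0,\infty)$ in $C^1(E^2)$ with $\Psi(x,y)=0$ iff $x=y$. This means the following. For each $\varepsilon>0$ let $\alpha$ run through a sequence of positive reals tending to infinity, and let $x_{\varepsilon,\alpha},y_{\varepsilon,\alpha}\in E$ and $\pi_{\varepsilon,\alpha}\in\mathcal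 P(F)$. Write $L_{\varepsilon,\alpha}=\Lambda(x_{\varepsilon,\alpha},\alpha\nabla\Psi(\cdot,y_{\varepsilon,\alpha})(x_{\varepsilon,\alpha}),\pi_{\varepsilon,\alpha})$ and $R_{\varepsilon,\alpha}=\Lambda(y_{\varepsilon,\alpha},-\alpha\nabla\Psi(x_{\varepsilon,\alpha},\cdot)(y_{\varepsilon,\alpha}),\pi_{\varepsilon,\alpha})$. Suppose that for each $\varepsilon$: the points $x_{\varepsilon,\alpha},y_{\varepsilon,\alpha}$ stay in a compact subset of $E$ and the $\pi_{\varepsilon,\alpha}$ in a compact subset of $\mathcal P(F)$; $\alpha\Psi(x_{\varepsilon,\alpha},y_{\varepsilon,\alpha})\to0$, and $\Psi=0$ at every limit point of $(x_{\varepsilon,\alpha},y_{\varepsilon,\alpha})$; $\sup_\alpha R_{\varepsilon,\alpha}<\infty$ and $\inf_\alpha L_{\varepsilon,\alpha}>-\infty$. Then $\liminf_{\alpha\to\infty}(L_{\varepsilon,\alpha}-R_{\varepsilon,\alpha})\le0$ for each $\varepsilon>0$. **Regularity of $\mathcal I$.** $\mathcal I$ takes values in $[0,\infty]$ and: (I1)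 $\mathcal I$ is lower semi-continuous on $E\times\mathcal P(F)$. (I2) For each $x$ there is $\pi$ with $\mathcal I(x,\pi)=0$. (I3) For every compact $K\subseteq E$ and every $M$, $\bigcup_{x\in K}\{\pi:\mathcal I(x,\pi)\le M\}$ is compact. (I4) For each $x\in E$ and compact $K\subseteq\mathcal P(F)$ there are an open neighbourhood $U\subseteq E$ of $x$ and constants $M',C_1',C_2'\ge0$ with $\mathcal I(y,\pi)\le\max\{M',C_1'\mathcal I(x,\pi)+C_2'\}$ for all $y\in U$, $\pi\in K$. (I5) For every compact $K\subseteq E$, $M\ge0$ and $\varepsilon>0$ there is $\delta>0$ such that $|\mathcal I(x,\pi)-\mathcal I(y,\pi)|\le\varepsilon$ whenever $x,y\in K$, $d(x,y)\le\delta$ and $\pi\in\bigcap_{x'\in K}\{\pi':\mathcal I(x',\pi')\le M\}$. **The equation.** The multivalued Hamiltonian $H$ is the set of pairs $(f,H_{f,\phi})$ with $f\in C_{cc}^\infty(E)$, $e^\phi\in\mathcal D$ and $$H_{f,\phi}(x,z)=V_{x,\nabla f(x)}(z)+e^{-\phi(z)}(A_xe^{\phi})(z).$$ For $\lambda>0$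 and $h\in C_b(E)$, a bounded upper semi-continuous $u:E\to\mathbb R$ is a viscosity subsolution of $f-\lambda Hf=h$ if for all $(f,g)\in H$ there are $(x_n,z_n)\in E\times F$ with $u(x_n)-f(x_n)\to\sup_x(u(x)-f(x))$ and $\limsup_n\big(u(x_n)-\lambda g(x_n,z_n)-h(x_n)\big)\le0$. A bounded lower semi-continuous $v:E\to\mathbb R$ is a viscosity supersolution if for all $(f,g)\in H$ there are $(x_n,z_n)\in E\times F$ with $v(x_n)-f(x_n)\to\inf_x(v(x)-f(x))$ and $\liminf_n\big(v(x_n)-\lambda g(x_n,z_n)-h(x_n)\big)\ge0$. **Theorem (comparison principle).** Let $\lambda>0$ and $h_1,h_2\in C_b(E)$. If $u$ is a viscosity subsolution of $f-\lambda Hf=h_1$ and $v$ is a viscosity supersolution of $f-\lambda Hf=h_2$, then $$\sup_{x\in E}\big(u(x)-v(x)\big)\le\sup_{x\in E}\big(h_1(x)-h_2(x)\big).$$ -/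

import Mathlib

open Filter Topology MeasureTheory
open scoped ContDiff

noncomputable section

namespace SlowFast

/-- A function is of class `C^n` on a (not necessarily open) set `S` if it is `C^n` on an open
neighbourhood of `S`.  Functions on `S` are represented by functions on the ambient space; if `S` is
contained in the closure of its interior, the gradient at points of `S` only depends on the values
on `S`. -/
def IsCk {W : Type*} [NormedAddCommGroup W] [NormedSpace ℝ W]
    (n : WithTop ℕ∞) (S : Set W) (f : W → ℝ) : Prop :=
  ∃ U : Set W, IsOpen U ∧ S ⊆ U ∧ ContDiffOn ℝ n f U

/-- The class `C_cc^∞(E)`: smooth functions on `E` that are constant outside a compact subset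
of `E`. -/
def IsSmoothCcc {d : ℕ} (E : Set (EuclideanSpace ℝ (Fin d)))
    (f : EuclideanSpace ℝ (Fin d) → ℝ) : Prop :=
  IsCk ∞ E f ∧ ∃ K : Set E, IsCompact K ∧ ∃ c : ℝ, ∀ x : E, x ∉ K → f x = c

/-! ### Viscosity sub- and supersolutions

An operator is a graph, a set of pairs `(f, g)` with `f` a function on `X` and `g` a function on
`X × F`. -/

/-- `u` is a viscosity subsolution of `f - lam * B f = h`. -/
def IsSubsolution {X F : Type*} [TopologicalSpace X]
    (B : Set ((X → ℝ) × (X × F → ℝ))) (lam : ℝ) (h u : X → ℝ) : Prop :=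
  (∃ C : ℝ, ∀ x, |u x| ≤ C) ∧ UpperSemicontinuous u ∧
    ∀ f g, (f, g) ∈ B → ∃ (x : ℕ → X) (z : ℕ → F),
      Tendsto (fun n => u (x n) - f (x n)) atTop (𝓝 (⨆ y, (u y - f y))) ∧
      limsup (fun n => ((u (x n) - lam * g (x n, z n) - h (x n) : ℝ) : EReal)) atTop ≤ 0

/-- `v` is a viscosity supersolution of `f - lam * B f = h`. -/
def IsSupersolution {X F : Type*} [TopologicalSpace X]
    (B : Set ((X → ℝ) × (X × F → ℝ))) (lam : ℝ) (h v : X → ℝ) : Prop :=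
  (∃ C : ℝ, ∀ x, |v x| ≤ C) ∧ LowerSemicontinuous v ∧
    ∀ f g, (f, g) ∈ B → ∃ (x : ℕ → X) (z : ℕ → F),
      Tendsto (fun n => v (x n) - f (x n)) atTop (𝓝 (⨅ y, (v y - f y))) ∧
      0 ≤ liminf (fun n => ((v (x n) - lam * g (x n, z n) - h (x n) : ℝ) : EReal)) atTop

/-! ### The limiting multivalued Hamiltonian -/

/-- The graph of all pairs `(f, H_{f,φ})` with `f ∈ C_cc^∞(E)`, `e^φ ∈ D` and
`H_{f,φ}(x,z) = V_{x,∇f(x)}(z) + e^{-φ(z)} (A_x e^φ)(z)`. -/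
def limitHamiltonian {d : ℕ} (E : Set (EuclideanSpace ℝ (Fin d)))
    {F : Type*} [TopologicalSpace F] (D : Submodule ℝ C(F, ℝ))
    (V : E → EuclideanSpace ℝ (Fin d) → C(F, ℝ)) (A : E → D →ₗ[ℝ] C(F, ℝ)) :
    Set ((E → ℝ) × (E × F → ℝ)) :=
  {q | ∃ f : EuclideanSpace ℝ (Fin d) → ℝ, IsSmoothCcc E f ∧
    ∃ (φ : F → ℝ) (g : D), (∀ z, (g : C(F, ℝ)) z = Real.exp (φ z)) ∧
      q.1 = (fun x : E => f x) ∧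
      q.2 = fun y : E × F =>
        V y.1 (gradient f (y.1 : EuclideanSpace ℝ (Fin d))) y.2 +
          Real.exp (-φ y.2) * A y.1 g y.2}

/-! ### Donsker-Varadhan functional and effective Hamiltonian -/

/-- `I(π) = - inf { ∫ (A g)/g dπ : g ∈ D, g > 0 }`.  As the underlying space will be compact,
`inf g > 0` is the same as pointwise positivity. -/
def donskerVaradhan {F : Type*} [TopologicalSpace F] [MeasurableSpace F]
    {D : Submodule ℝ C(F, ℝ)} (A : D →ₗ[ℝ] C(F, ℝ)) (π : ProbabilityMeasure F) : EReal :=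
  - ⨅ (g : D) (_ : ∀ z, 0 < (g : C(F, ℝ)) z),
      ((∫ z, A g z / (g : C(F, ℝ)) z ∂(π : Measure F) : ℝ) : EReal)

/-- `Λ(x,p,π) = ∫ V_{x,p}(z) π(dz)`. -/
def averagedV {X P F : Type*} [TopologicalSpace F] [MeasurableSpace F]
    (V : X → P → C(F, ℝ)) (x : X) (p : P) (π : ProbabilityMeasure F) : ℝ :=
  ∫ z, V x p z ∂(π : Measure F)

/-- `ℋ(x,p) = sup_π { ∫ V_{x,p} dπ - I(x,π) }`. -/
def effectiveHamiltonian {X P F : Type*} [TopologicalSpace F] [MeasurableSpace F]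
    [OpensMeasurableSpace F] {D : Submodule ℝ C(F, ℝ)}
    (V : X → P → C(F, ℝ)) (A : X → D →ₗ[ℝ] C(F, ℝ)) (x : X) (p : P) : EReal :=
  ⨆ π : ProbabilityMeasure F, ((averagedV V x p π : ℝ) : EReal) - donskerVaradhan (A x) π

/-! ### Assumption on the principal eigenvalue problem -/

structure PrincipalEigenvalueAssumption {X P F : Type*} [TopologicalSpace F] [MeasurableSpace F]
    [OpensMeasurableSpace F] (D : Submodule ℝ C(F, ℝ))
    (V : X → P → C(F, ℝ)) (A : X → D →ₗ[ℝ] C(F, ℝ)) : Prop where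
  /-- positive elements of the domain may be raised to powers `1 - ε` -/
  domain_rpow : ∀ g ∈ D, (∀ z, 0 < g z) → ∀ ε ∈ Set.Ioo (0 : ℝ) 1,
    ∃ g' ∈ D, ∀ z, g' z = (g z) ^ (1 - ε)
  /-- `|(V_{x,p} + A_x) g - ℋ(x,p) g| ≤ δ g` for some strictly positive `g` in the domain -/
  solvable : ∀ (x : X) (p : P) (δ : ℝ), 0 < δ →
    ∃ g : D, (∀ z, 0 < (g : C(F, ℝ)) z) ∧ ∀ z,
      ((V x p z + A x g z / (g : C(F, ℝ)) z - δ : ℝ) : EReal) ≤ effectiveHamiltonian V A x p ∧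
      effectiveHamiltonian V A x p ≤ ((V x p z + A x g z / (g : C(F, ℝ)) z + δ : ℝ) : EReal)

/-! ### Penalization functions, containment functions and the continuity estimate -/

structure IsPenalization {d : ℕ} (E : Set (EuclideanSpace ℝ (Fin d)))
    (Ψ : EuclideanSpace ℝ (Fin d) → EuclideanSpace ℝ (Fin d) → ℝ) : Prop where
  isC1 : IsCk 1 (E ×ˢ E) (Function.uncurry Ψ)
  nonneg : ∀ x ∈ E, ∀ y ∈ E, 0 ≤ Ψ x y
  eq_zero_iff : ∀ x ∈ E, ∀ y ∈ E, Ψ x y = 0 ↔ x = y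

structure IsContainment {d : ℕ} (E : Set (EuclideanSpace ℝ (Fin d)))
    {F : Type*} [TopologicalSpace F] (V : E → EuclideanSpace ℝ (Fin d) → C(F, ℝ))
    (Υ : EuclideanSpace ℝ (Fin d) → ℝ) : Prop where
  isC1 : IsCk 1 E Υ
  nonneg : ∀ x ∈ E, 0 ≤ Υ x
  compact_sublevel : ∀ c : ℝ, IsCompact {x : E | Υ x ≤ c}
  bounded : ∃ c : ℝ, ∀ (x : E) (z : F), V x (gradient Υ (x : EuclideanSpace ℝ (Fin d))) z ≤ c

/-- `G(x, α ∇Ψ(·,y)(x), π)` -/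
def leftValue {d : ℕ} {E : Set (EuclideanSpace ℝ (Fin d))} {Q : Type*}
    (G : E → EuclideanSpace ℝ (Fin d) → Q → ℝ)
    (Ψ : EuclideanSpace ℝ (Fin d) → EuclideanSpace ℝ (Fin d) → ℝ)
    (α : ℝ) (x y : E) (π : Q) : ℝ :=
  G x (α • gradient (fun w => Ψ w y) (x : EuclideanSpace ℝ (Fin d))) π

/-- `G(y, -α ∇Ψ(x,·)(y), π)` -/
def rightValue {d : ℕ} {E : Set (EuclideanSpace ℝ (Fin d))} {Q : Type*}
    (G : E → EuclideanSpace ℝ (Fin d) → Q → ℝ)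
    (Ψ : EuclideanSpace ℝ (Fin d) → EuclideanSpace ℝ (Fin d) → ℝ)
    (α : ℝ) (x y : E) (π : Q) : ℝ :=
  G y (-(α • gradient (fun w => Ψ x w) (y : EuclideanSpace ℝ (Fin d)))) π

/-- For each `ε > 0`, `k ↦ α ε k` is a sequence of positive reals tending to infinity, and
`x ε k`, `y ε k`, `π ε k` are the variables that belong to `ε` and `α ε k`. -/
structure IsFundamental {d : ℕ} {E : Set (EuclideanSpace ℝ (Fin d))} {Q : Type*}
    [TopologicalSpace Q] (G : E → EuclideanSpace ℝ (Fin d) → Q → ℝ)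
    (Ψ : EuclideanSpace ℝ (Fin d) → EuclideanSpace ℝ (Fin d) → ℝ)
    (α : ℝ → ℕ → ℝ) (x y : ℝ → ℕ → E) (π : ℝ → ℕ → Q) : Prop where
  pos : ∀ ε > 0, ∀ k, 0 < α ε k
  tendsto_atTop : ∀ ε > 0, Tendsto (α ε) atTop atTop
  compact : ∀ ε > 0, ∃ (K : Set E) (K' : Set Q), IsCompact K ∧ IsCompact K' ∧
    ∀ k, x ε k ∈ K ∧ y ε k ∈ K ∧ π ε k ∈ K'
  penalty : ∀ ε > 0, Tendsto (fun k => α ε k * Ψ (x ε k) (y ε k)) atTop (𝓝 0)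
  cluster : ∀ ε > 0, ∀ q : E × E,
    MapClusterPt q atTop (fun k => (x ε k, y ε k)) → Ψ q.1 q.2 = 0
  bddAbove : ∀ ε > 0,
    BddAbove (Set.range fun k => rightValue G Ψ (α ε k) (x ε k) (y ε k) (π ε k))
  bddBelow : ∀ ε > 0,
    BddBelow (Set.range fun k => leftValue G Ψ (α ε k) (x ε k) (y ε k) (π ε k))

/-- The continuity estimate for `G` with respect to the penalization function `Ψ`. -/
def ContinuityEstimate {d : ℕ} {E : Set (EuclideanSpace ℝ (Fin d))} {Q : Type*}
    [TopologicalSpace Q] (G : E → EuclideanSpace ℝ (Fin d) → Q → ℝ)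
    (Ψ : EuclideanSpace ℝ (Fin d) → EuclideanSpace ℝ (Fin d) → ℝ) : Prop :=
  ∀ (α : ℝ → ℕ → ℝ) (x y : ℝ → ℕ → E) (π : ℝ → ℕ → Q), IsFundamental G Ψ α x y π →
    ∀ ε > 0, liminf (fun k =>
      ((leftValue G Ψ (α ε k) (x ε k) (y ε k) (π ε k) -
        rightValue G Ψ (α ε k) (x ε k) (y ε k) (π ε k) : ℝ) : EReal)) atTop ≤ 0

/-! ### Regularity of the internal Hamiltonian `V` -/

structure RegularV {d : ℕ} (E : Set (EuclideanSpace ℝ (Fin d)))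
    {F : Type*} [TopologicalSpace F] [MeasurableSpace F] [OpensMeasurableSpace F]
    (V : E → EuclideanSpace ℝ (Fin d) → C(F, ℝ)) : Prop where
  /-- `(x,p) ↦ V_{x,p}` is continuous into `C(F)`; for compact `F` the topology is that of the
  supremum norm -/
  continuous : Continuous fun q : E × EuclideanSpace ℝ (Fin d) => V q.1 q.2
  convex : ∀ x z, ConvexOn ℝ Set.univ fun p => V x p z
  zero : ∀ x z, V x 0 z = 0
  containment : ∃ Υ : EuclideanSpace ℝ (Fin d) → ℝ, IsContainment E V Υ
  growth : ∀ K : Set E, IsCompact K → ∃ M C₁ C₂ : ℝ, 0 ≤ M ∧ 0 ≤ C₁ ∧ 0 ≤ C₂ ∧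
    ∀ x ∈ K, ∀ p z₁ z₂, V x p z₁ ≤ max M (C₁ * V x p z₂ + C₂)
  continuityEstimate : ∃ Ψ : EuclideanSpace ℝ (Fin d) → EuclideanSpace ℝ (Fin d) → ℝ,
    IsPenalization E Ψ ∧ ContinuityEstimate (averagedV V) Ψ

/-! ### Regularity of the cost functional `I` -/

/-- `Θ_{K,M}`, the union over `x ∈ K` of the sublevel sets `{π : I(x,π) ≤ M}`. -/
def unionSublevel {X Q : Type*} (I : X → Q → EReal) (K : Set X) (M : ℝ) : Set Q :=
  ⋃ x ∈ K, {π | I x π ≤ (M : EReal)}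

/-- `Ω_{K,M}`, the intersection over `x ∈ K` of the sublevel sets `{π : I(x,π) ≤ M}`. -/
def interSublevel {X Q : Type*} (I : X → Q → EReal) (K : Set X) (M : ℝ) : Set Q :=
  ⋂ x ∈ K, {π | I x π ≤ (M : EReal)}

structure RegularI {X Q : Type*} [PseudoMetricSpace X] [TopologicalSpace Q]
    (I : X → Q → EReal) : Prop where
  /-- `I` takes values in `[0,∞]` -/
  nonneg : ∀ x π, 0 ≤ I x π
  lsc : LowerSemicontinuous fun q : X × Q => I q.1 q.2
  exists_zero : ∀ x, ∃ π, I x π = 0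
  compact_sublevel : ∀ K : Set X, IsCompact K → ∀ M : ℝ, IsCompact (unionSublevel I K M)
  finiteness : ∀ (x : X) (K : Set Q), IsCompact K →
    ∃ U : Set X, IsOpen U ∧ x ∈ U ∧ ∃ M C₁ C₂ : ℝ, 0 ≤ M ∧ 0 ≤ C₁ ∧ 0 ≤ C₂ ∧
      ∀ y ∈ U, ∀ π ∈ K, I y π ≤ max (M : EReal) ((C₁ : EReal) * I x π + (C₂ : EReal))
  equicontinuous : ∀ K : Set X, IsCompact K → ∀ M : ℝ, 0 ≤ M → ∀ ε : ℝ, 0 < ε →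
    ∃ δ : ℝ, 0 < δ ∧ ∀ π ∈ interSublevel I K M, ∀ x ∈ K, ∀ y ∈ K, dist x y ≤ δ →
      |(I x π).toReal - (I y π).toReal| ≤ ε

end SlowFast

end

/-!
The proof doubles variables, with one left variable and many right variables.

*Why not one right variable.* Let `U` and `W` be the sub- and supersolution, tilted by the
containment function `Υ` and rescaled. Classical doubling maximizes `U x - W y - α Ψ(x, y)`. The
viscosity inequality at `x` produces a nearly optimal measure `π` for `ℋ(x, ·)`, and `π` is then
inserted into the inequality at `y`. This needs `I(y, π)` to be close to `I(x, π)` while `x`, `y`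
and `π` all vary. The local bound on `I` controls `I(y, ·)` only through the values of `I` at a
fixed centre `x`, so the comparison is available only for a fixed pair `(x, π)` and `y → x`
(`RegularI.eventually_abs_toReal_sub_le`): the error of the doubling tends to zero pointwise in
`(x, π)`, but not uniformly.

*From pointwise to uniform.* Upper semicontinuous functions on a compact space which are uniformly
bounded above and pointwise asymptotically nonpositive have a convex combination that is uniformly
at most `δ` (`exists_weights_sum_le`, a one-sided form of a lemma of Simons). For weights `w k` of
such a combination one maximizes `U x - ∑ k, w k * (W (y k) + P k x (y k))` over `x` and all `y k`
(`exists_max_sub_sum_min`). Each `y k` then minimizes its own summand, which gives one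
supersolution inequality per `k`, and `x` is a touching point for a sum of penalties. Because
`p ↦ V x p` is convex, one measure `π`, nearly optimal at `x`, serves all `k` at the same time
(`sub_ineq`). The averaged errors are at most `δ` whatever `x` and `π` turned out to be.

*Uniform bound on the errors.* The penalty `α k * Ψ` is capped: `P k` is the minimum of `α k * Ψ`
and `α₀ * Ψ + η`, with the branch recorded by a Boolean. On the first branch `α k * Ψ` is small and
the continuity estimate bounds the left values `Λ(x, α ∇Ψ, π)`; on the second branch the slope is
fixed and they are bounded by compactness. The second branch is excluded by adding to the error a
multiple of the value of the doubled functional minus the maximum of `U - W`: for `α₀` large this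
difference is at most `-η / 2` there.

*Viscosity inequalities.* Evaluating the multivalued Hamiltonian at the logarithm of a
near-eigenfunction gives the inequality for the effective Hamiltonian `ℋ`. A localized quadratic
test function (`exists_smoothCcc_test`) shows that it holds for every function that is
differentiable at the touching point (`IsSubsolution.le_of_touching`,
`IsSupersolution.le_of_touching`).

`DoublingSetting.perturbed_sub_le` is the resulting estimate for fixed `ε`, and the theorem follows
as `ε → 0`.
-/

namespace SlowFast

/-! ### Convex combinations of pointwise vanishing upper semicontinuous functions -/

/-- Simons' lemma: nonnegative, uniformly bounded, upper semicontinuous functions on a compact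
space that tend to zero pointwise have convex combinations that are uniformly small. The
combination is among functions `g n`, each chosen almost minimally for the supremum of the partial
sum `∑ i < n, 2⁻⁽ⁱ⁺¹⁾ g i` plus `2⁻ⁿ g n`. If all convex combinations had supremum above `δ`, the
tail sums of `∑ 2⁻⁽ⁱ⁺¹⁾ g i` at a maximum point `x` of the whole series would be at least
`2⁻ⁿ δ / 2`, which contradicts `g i x → 0`. -/
theorem exists_mem_convexHull_le {X : Type*} [TopologicalSpace X] [CompactSpace X]
    (f : ℕ → X → ℝ) {C : ℝ} (hf : ∀ k, UpperSemicontinuous (f k)) (h0 : ∀ k x, 0 ≤ f k x)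
    (hC : ∀ k x, f k x ≤ C) (hlim : ∀ x, ∀ δ > 0, ∀ᶠ k in atTop, f k x < δ) {δ : ℝ} (hδ : 0 < δ) :
    ∃ g ∈ convexHull ℝ (Set.range f), ∀ x, g x ≤ δ := by
  by_contra! hcon
  obtain ⟨x₀, -⟩ := hcon (f 0) (subset_convexHull ℝ _ ⟨0, rfl⟩)
  have : Nonempty X := ⟨x₀⟩
  have hC0 : 0 ≤ C := (h0 0 x₀).trans (hC 0 x₀)
  set T : ℕ → Set (X → ℝ) := fun n => convexHull ℝ (f '' Set.Ici n) with hT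
  have hTne : ∀ n, (T n).Nonempty := fun n => ⟨f n, subset_convexHull ℝ _ ⟨n, le_refl n, rfl⟩⟩
  have hTconv : ∀ n, Convex ℝ (T n) := fun n => convex_convexHull ℝ _
  have hTmono : ∀ n, T (n + 1) ⊆ T n := fun n =>
    convexHull_mono (Set.image_mono (Set.Ici_subset_Ici.2 n.le_succ))
  have hTrange : ∀ n, T n ⊆ convexHull ℝ (Set.range f) := fun n =>
    convexHull_mono (Set.image_subset_range _ _)
  have hTusc : ∀ n, ∀ g ∈ T n, UpperSemicontinuous g := by
    intro n g hg
    refine convexHull_min (t := {g : X → ℝ | UpperSemicontinuous g}) ?_ ?_ hg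
    · rintro _ ⟨k, -, rfl⟩
      exact hf k
    · intro g₁ hg₁ g₂ hg₂ a b ha hb _
      have hm : ∀ c : ℝ, 0 ≤ c → ∀ g : X → ℝ, UpperSemicontinuous g →
          UpperSemicontinuous (c • g) := fun c hc g hg =>
        (continuous_const_mul c).comp_upperSemicontinuous hg
          (fun s t hst => mul_le_mul_of_nonneg_left hst hc)
      exact (hm a ha _ hg₁).add (hm b hb _ hg₂)
  have hTle : ∀ n x c, (∀ k ≥ n, f k x ≤ c) → ∀ g ∈ T n, g x ≤ c := by
    intro n x c hc g hg
    refine convexHull_min (t := {g : X → ℝ | g x ≤ c}) ?_ ?_ hg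
    · rintro _ ⟨k, hk, rfl⟩
      exact hc k hk
    · exact convex_halfSpace_le (f := fun g : X → ℝ => g x) ⟨fun _ _ => rfl, fun _ _ => rfl⟩ c
  have hTge : ∀ n x, ∀ g ∈ T n, 0 ≤ g x := by
    intro n x g hg
    refine convexHull_min (t := {g : X → ℝ | 0 ≤ g x}) ?_ ?_ hg
    · rintro _ ⟨k, -, rfl⟩
      exact h0 k x
    · exact convex_halfSpace_ge (f := fun g : X → ℝ => g x) ⟨fun _ _ => rfl, fun _ _ => rfl⟩ 0
  set p : (X → ℝ) → ℝ := fun g => ⨆ x, g x with hp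
  set κ : ℝ := δ / 6 with hκ
  have hκ0 : 0 < κ := by positivity
  have hpow : ∀ n : ℕ, (0 : ℝ) < (1 / 2) ^ n := fun n => by positivity
  -- Almost minimal choices. The accuracy is summable with the weights of the telescoping in
  -- `hPmono`: `3 / 4 * 4⁻ⁿ = 4⁻ⁿ - 4⁻⁽ⁿ⁺¹⁾`.
  have key : ∀ (n : ℕ) (s : X → ℝ), (∀ x, 0 ≤ s x) → ∃ g ∈ T n, ∀ g' ∈ T n,
      p (s + (1 / 2 : ℝ) ^ n • g) ≤ p (s + (1 / 2 : ℝ) ^ n • g') + 3 / 4 * κ * (1 / 4) ^ n := by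
    intro n s hs
    set S := (fun g => p (s + (1 / 2 : ℝ) ^ n • g)) '' T n
    have hS : S.Nonempty := (hTne n).image _
    have hSb : BddBelow S := by
      refine ⟨0, ?_⟩
      rintro _ ⟨g, hg, rfl⟩
      exact Real.iSup_nonneg fun x => add_nonneg (hs x) (mul_nonneg (hpow n).le (hTge n x g hg))
    have hε : 0 < 3 / 4 * κ * (1 / 4 : ℝ) ^ n := by positivity
    obtain ⟨_, ⟨g, hg, rfl⟩, hlt⟩ := exists_lt_of_csInf_lt hS (lt_add_of_pos_right (sInf S) hε)
    refine ⟨g, hg, fun g' hg' => hlt.le.trans ?_⟩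
    gcongr
    exact csInf_le hSb ⟨g', hg', rfl⟩
  choose! G hGT hGmin using key
  let s : ℕ → X → ℝ := fun n => Nat.rec 0 (fun n s => s + (1 / 2 : ℝ) ^ (n + 1) • G n s) n
  have hs0 : s 0 = 0 := rfl
  have hs1 : ∀ n, s (n + 1) = s n + (1 / 2 : ℝ) ^ (n + 1) • G n (s n) := fun n => rfl
  have hsnn : ∀ n x, 0 ≤ s n x := by
    intro n
    induction n with
    | zero => intro x; simp [hs0]
    | succ n ih =>
      intro x
      rw [hs1]
      exact add_nonneg (ih x) (mul_nonneg (hpow _).le (hTge n x _ (hGT n _ ih)))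
  set g : ℕ → X → ℝ := fun n => G n (s n) with hg
  have hgT : ∀ n, g n ∈ T n := fun n => hGT n _ (hsnn n)
  have hgmin : ∀ n, ∀ g' ∈ T n,
      p (s n + (1 / 2 : ℝ) ^ n • g n) ≤ p (s n + (1 / 2 : ℝ) ^ n • g') + 3 / 4 * κ * (1 / 4) ^ n :=
    fun n => hGmin n _ (hsnn n)
  have hs1x : ∀ n x, s (n + 1) x = s n x + (1 / 2 : ℝ) ^ (n + 1) * g n x := fun n x => rfl
  have hg0 : ∀ n x, 0 ≤ g n x := fun n x => hTge n x _ (hgT n)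
  have hgC : ∀ n x, g n x ≤ C := fun n x => hTle n x C (fun k _ => hC k x) _ (hgT n)
  have hsmono : ∀ x, Monotone fun n => s n x := fun x => monotone_nat_of_le_succ fun n => by
    rw [hs1x]
    exact le_add_of_nonneg_right (mul_nonneg (hpow _).le (hg0 n x))
  have htail : ∀ (x : X) (c : ℝ) (n : ℕ), (∀ i ≥ n, g i x ≤ c) → ∀ m ≥ n,
      s m x + (1 / 2) ^ m * c ≤ s n x + (1 / 2) ^ n * c := by
    intro x c n hc m hm
    induction m, hm using Nat.le_induction with
    | base => exact le_rfl
    | succ m hm ih =>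
      refine le_trans ?_ ih
      rw [hs1x, pow_succ]
      nlinarith [hc m hm, hpow m]
  have hanti : ∀ x, Antitone fun n => s n x + (1 / 2) ^ n * C := fun x n m hnm =>
    htail x C n (fun i _ => hgC i x) m hnm
  have hsle : ∀ x n m, s m x ≤ s n x + (1 / 2) ^ n * C := by
    intro x n m
    have h1 := hsmono x (le_max_right n m)
    have h2 := hanti x (le_max_left n m)
    have h3 : 0 ≤ (1 / 2 : ℝ) ^ (max n m) * C := mul_nonneg (hpow _).le hC0
    simp only at h1 h2
    linarith
  have hsusc : ∀ n, UpperSemicontinuous (s n) := by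
    intro n
    induction n with
    | zero => exact upperSemicontinuous_const
    | succ n ih =>
      rw [hs1]
      refine ih.add ?_
      exact (continuous_const_mul _).comp_upperSemicontinuous (hTusc n _ (hgT n))
        (fun a b hab => mul_le_mul_of_nonneg_left hab (hpow _).le)
  set L : X → ℝ := fun x => ⨅ n, (s n x + (1 / 2) ^ n * C) with hL
  have hbdd : ∀ x, BddBelow (Set.range fun n => s n x + (1 / 2) ^ n * C) := by
    intro x
    refine ⟨0, ?_⟩
    rintro _ ⟨n, rfl⟩
    exact add_nonneg (hsnn n x) (mul_nonneg (hpow n).le hC0)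
  have hLusc : UpperSemicontinuous L := by
    refine upperSemicontinuous_ciInf hbdd fun n => ?_
    exact (hsusc n).add upperSemicontinuous_const
  have hsL : ∀ n x, s n x ≤ L x := fun n x => le_ciInf fun m => hsle x m n
  have hLs : ∀ n x, L x ≤ s n x + (1 / 2) ^ n * C := fun n x => ciInf_le (hbdd x) n
  obtain ⟨x, -, hx⟩ := (hLusc.upperSemicontinuousOn Set.univ).exists_isMaxOn
    Set.univ_nonempty isCompact_univ
  have hxmax : ∀ y, L y ≤ L x := fun y => hx (Set.mem_univ y)
  -- bounded suprema
  have hpb : ∀ n, BddAbove (Set.range (s n + (1 / 2 : ℝ) ^ n • g n)) := by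
    intro n
    refine ⟨L x + (1 / 2) ^ n * C, ?_⟩
    rintro _ ⟨y, rfl⟩
    exact add_le_add ((hsL n y).trans (hxmax y)) (mul_le_mul_of_nonneg_left (hgC n y) (hpow n).le)
  have hPle : ∀ n, p (s n + (1 / 2 : ℝ) ^ n • g n) ≤ L x + (1 / 2) ^ n * C := by
    intro n
    refine ciSup_le fun y => ?_
    exact add_le_add ((hsL n y).trans (hxmax y)) (mul_le_mul_of_nonneg_left (hgC n y) (hpow n).le)
  -- The midpoint of `g n` and `g (n + 1)` is a competitor at step `n`, and leads to the functional
  -- of step `n + 1`.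
  have hPmono : Monotone fun n => p (s n + (1 / 2 : ℝ) ^ n • g n) - κ * (1 / 4) ^ n := by
    refine monotone_nat_of_le_succ fun n => ?_
    have hmem : (1 / 2 : ℝ) • g n + (1 / 2 : ℝ) • g (n + 1) ∈ T n :=
      hTconv n (hgT n) (hTmono n (hgT (n + 1))) (by norm_num) (by norm_num) (by norm_num)
    have h1 := hgmin n _ hmem
    have h2 : s n + (1 / 2 : ℝ) ^ n • ((1 / 2 : ℝ) • g n + (1 / 2 : ℝ) • g (n + 1)) =
        s (n + 1) + (1 / 2 : ℝ) ^ (n + 1) • g (n + 1) := by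
      funext y
      simp only [Pi.add_apply, Pi.smul_apply, smul_eq_mul, hs1x, pow_succ]
      ring
    rw [h2] at h1
    rw [pow_succ (1 / 4 : ℝ)]
    linarith
  have hPL : ∀ n, p (s n + (1 / 2 : ℝ) ^ n • g n) ≤ L x + κ * (1 / 4) ^ n := by
    intro n
    have hlim' : Tendsto (fun m : ℕ => L x + (1 / 2 : ℝ) ^ m * C) atTop (𝓝 (L x + 0 * C)) :=
      tendsto_const_nhds.add
        ((tendsto_pow_atTop_nhds_zero_of_lt_one (by norm_num) (by norm_num)).mul_const C)
    have : p (s n + (1 / 2 : ℝ) ^ n • g n) - κ * (1 / 4) ^ n ≤ L x + 0 * C := by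
      refine ge_of_tendsto hlim' (eventually_atTop.2 ⟨n, fun m hm => ?_⟩)
      refine (hPmono hm).trans (le_trans ?_ (hPle m))
      have : 0 ≤ κ * (1 / 4 : ℝ) ^ m := by positivity
      linarith
    linarith
  have hLδ : δ - κ ≤ L x := by
    obtain ⟨y, hy⟩ := hcon (g 0) (hTrange 0 (hgT 0))
    have h1 := le_ciSup (hpb 0) y
    have h2 := hPL 0
    simp only [hp] at h2
    simp only [hs0, pow_zero, one_smul, zero_add, mul_one] at h1 h2
    linarith
  -- The partial sums stay below the maximum of the series by a definite multiple of `2⁻ⁿ`.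
  have hsgap : ∀ n y, s n y ≤ L x - (1 / 2) ^ n * (δ / 2 + 2 * κ * (1 / 2) ^ n) := by
    intro n
    induction n with
    | zero =>
      intro y
      simp only [hs0, Pi.zero_apply, pow_zero]
      linarith
    | succ n ih =>
      intro y
      have h1 := ih y
      have h2 := (le_ciSup (hpb n) y).trans (hPL n)
      simp only [Pi.add_apply, Pi.smul_apply, smul_eq_mul] at h2
      have h4 : (1 / 4 : ℝ) ^ n = (1 / 2) ^ n * (1 / 2) ^ n := by
        rw [← mul_pow]; norm_num
      rw [h4] at h2
      rw [hs1x, pow_succ]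
      nlinarith
  obtain ⟨n, hn⟩ := eventually_atTop.1 (hlim x (δ / 4) (by positivity))
  have hgs : ∀ i ≥ n, g i x ≤ δ / 4 := fun i hi =>
    hTle i x _ (fun k hk => (hn k (hi.trans hk)).le) _ (hgT i)
  have hfin : ∀ m ≥ n, L x ≤ L x - (1 / 2) ^ n * (δ / 4) + (1 / 2) ^ m * C := by
    intro m hm
    have h1 := htail x _ n hgs m hm
    have h2 := hLs m x
    have h3 := hsgap n x
    have h5 : 0 ≤ (1 / 2 : ℝ) ^ n * (2 * κ * (1 / 2) ^ n) := by positivity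
    have h6 : 0 ≤ (1 / 2 : ℝ) ^ m * (δ / 4) := by positivity
    nlinarith
  have hlim' : Tendsto (fun m : ℕ => L x - (1 / 2) ^ n * (δ / 4) + (1 / 2 : ℝ) ^ m * C) atTop
      (𝓝 (L x - (1 / 2) ^ n * (δ / 4) + 0 * C)) :=
    tendsto_const_nhds.add
      ((tendsto_pow_atTop_nhds_zero_of_lt_one (by norm_num) (by norm_num)).mul_const C)
  have := ge_of_tendsto hlim' (eventually_atTop.2 ⟨n, hfin⟩)
  have h7 : 0 < (1 / 2 : ℝ) ^ n * (δ / 4) := by positivity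
  linarith

/-- The one-sided form of `exists_mem_convexHull_le`, with explicit weights: it is applied to the
positive parts. -/
theorem exists_weights_sum_le {T : Type*} [TopologicalSpace T] {Q : Set T} (hQ : IsCompact Q)
    (f : ℕ → T → ℝ) {C : ℝ} (hf : ∀ k, UpperSemicontinuousOn (f k) Q)
    (hC : ∀ k, ∀ q ∈ Q, f k q ≤ C)
    (hlim : ∀ q ∈ Q, ∀ δ > 0, ∀ᶠ k in atTop, f k q < δ) {δ : ℝ} (hδ : 0 < δ) :
    ∃ (s : Finset ℕ) (w : ℕ → ℝ), (∀ k ∈ s, 0 ≤ w k) ∧ ∑ k ∈ s, w k = 1 ∧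
      ∀ q ∈ Q, ∑ k ∈ s, w k * f k q ≤ δ := by
  have : CompactSpace Q := isCompact_iff_compactSpace.1 hQ
  set F : ℕ → Q → ℝ := fun k q => max (f k q) 0 with hF
  obtain ⟨g, hg, hgδ⟩ := exists_mem_convexHull_le F (C := max C 0)
    (fun k => (upperSemicontinuousOn_iff_restrict.2 (hf k)).sup upperSemicontinuous_const)
    (fun k x => le_max_right _ _) (fun k x => max_le_max (hC k x x.2) le_rfl)
    (fun x δ hδ => (hlim x x.2 δ hδ).mono fun k hk => max_lt hk hδ) hδ
  rw [convexHull_range_eq_exists_affineCombination] at hg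
  obtain ⟨s, w, hw0, hw1, rfl⟩ := hg
  refine ⟨s, w, hw0, hw1, fun q hq => ?_⟩
  have h := hgδ ⟨q, hq⟩
  rw [Finset.affineCombination_eq_linear_combination _ _ _ hw1] at h
  simp only [Finset.sum_apply, Pi.smul_apply, smul_eq_mul] at h
  refine le_trans (Finset.sum_le_sum fun k hk => ?_) h
  exact mul_le_mul_of_nonneg_left (le_max_left _ _) (hw0 k hk)

/-! ### Gradients -/

section Gradient

variable {W : Type*} [NormedAddCommGroup W] [InnerProductSpace ℝ W] [CompleteSpace W]
  {f g : W → ℝ} {p q x : W}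

theorem hasGradientAt_add (hf : HasGradientAt f p x) (hg : HasGradientAt g q x) :
    HasGradientAt (fun y => f y + g y) (p + q) x := by
  rw [hasGradientAt_iff_hasFDerivAt] at *
  rw [map_add]
  exact hf.add hg

theorem hasGradientAt_const_mul (c : ℝ) (hf : HasGradientAt f p x) :
    HasGradientAt (fun y => c * f y) (c • p) x := by
  rw [hasGradientAt_iff_hasFDerivAt] at *
  rw [map_smulₛₗ]
  exact hf.const_mul c

theorem hasGradientAt_neg (hf : HasGradientAt f p x) : HasGradientAt (fun y => -f y) (-p) x := by
  simpa using hasGradientAt_const_mul (-1) hf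

theorem hasGradientAt_sum {ι : Type*} (s : Finset ι) {f : ι → W → ℝ} {p : ι → W}
    (hf : ∀ i ∈ s, HasGradientAt (f i) (p i) x) :
    HasGradientAt (fun y => ∑ i ∈ s, f i y) (∑ i ∈ s, p i) x := by
  rw [hasGradientAt_iff_hasFDerivAt, map_sum]
  exact HasFDerivAt.fun_sum fun i hi => hasGradientAt_iff_hasFDerivAt.1 (hf i hi)

theorem hasGradientAt_inner_sub_add_norm_sq (p x₀ : W) (N : ℝ) (x : W) :
    HasGradientAt (fun y => inner ℝ p (y - x₀) + N * ‖y - x₀‖ ^ 2)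
      (p + N • ((2 : ℝ) • (x - x₀))) x := by
  refine hasGradientAt_add ?_ (hasGradientAt_const_mul N ?_)
  · rw [hasGradientAt_iff_hasFDerivAt]
    have h := ((InnerProductSpace.toDual ℝ W p).hasFDerivAt (x := x - x₀)).comp x
      ((hasFDerivAt_id x).sub_const x₀)
    exact h.congr_fderiv (by ext y; simp)
  · rw [hasGradientAt_iff_hasFDerivAt]
    have h := ((hasFDerivAt_id (𝕜 := ℝ) x).sub_const x₀).norm_sq
    exact h.congr_fderiv (by ext y; simp)

end Gradient

/-! ### Smooth test functions -/

/-- The elementary inequality behind the localization: an almost maximizer, at distance `s` from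
the touching point, of a convex combination (with cutoff `t`) of a concave quadratic bound `a` and
a value `b ≤ -1` is close to the centre. -/
theorem quadratic_near_max {κ N τ s a b t : ℝ} (hN : 0 < N) (hτ : N * τ ≤ κ ^ 2 / 32)
    (hτ1 : τ ≤ 1 / 2) (hτ0 : 0 < τ) (ht0 : 0 ≤ t) (ht1 : t ≤ 1) (hκ : 0 < κ)
    (ha : a ≤ κ / 4 * s - N * s ^ 2) (hb : b ≤ -1) (h : -τ ≤ t * a + (1 - t) * b) :
    N * s < κ / 2 := by
  by_contra! hcon
  have h2 : N * a ≤ -(κ ^ 2 / 8) := by nlinarith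
  have h3 : a ≤ -2 * τ := by
    have : N * a ≤ N * (-2 * τ) := by nlinarith
    exact le_of_mul_le_mul_left this hN
  nlinarith

/-- If `w - f` is maximal at `x₀` and `f` is merely differentiable there, there is a test function
in `C_cc^∞(E)` all of whose almost touching points are close to `x₀`, with gradient close to that
of `f` and with `w` not much below `w x₀`. It is the first order Taylor polynomial plus a steep
parabola near `x₀`, and a large constant away from `x₀`. -/
theorem exists_smoothCcc_test {d : ℕ} {E : Set (EuclideanSpace ℝ (Fin d))} {w : E → ℝ} {B : ℝ}
    (hB : ∀ x, |w x| ≤ B) {x₀ : E} (hloc : ∃ K : Set E, IsCompact K ∧ K ∈ 𝓝 x₀)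
    {f : EuclideanSpace ℝ (Fin d) → ℝ} {p : EuclideanSpace ℝ (Fin d)}
    (hf : HasGradientAt f p x₀) (hmax : ∀ x : E, w x - f x ≤ w x₀ - f x₀) {κ : ℝ} (hκ : 0 < κ) :
    ∃ ft : EuclideanSpace ℝ (Fin d) → ℝ, IsSmoothCcc E ft ∧
      ∃ τ > 0, ∀ x : E, (⨆ y : E, (w y - ft y)) - τ ≤ w x - ft x →
        dist x x₀ ≤ κ ∧ dist (gradient ft x) p ≤ κ ∧ w x₀ ≤ w x + κ := by
  obtain ⟨K, hK, hKx⟩ := hloc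
  -- the radius of the localization
  have hlin := hasGradientAt_iff_isLittleO.1 hf
  have hlin' := hlin.def (show 0 < κ / 4 by positivity)
  obtain ⟨r₁, hr₁, hball⟩ := Metric.eventually_nhds_iff.1 hlin'
  obtain ⟨r₂, hr₂, hKball⟩ := Metric.mem_nhds_iff.1 hKx
  set r : ℝ := min 1 (min (r₁ / 2) (r₂ / 2)) with hr
  have hr0 : 0 < r := by positivity
  have hr1 : r ≤ 1 := min_le_left _ _
  have hrr₁ : r < r₁ := by
    have : r ≤ r₁ / 2 := (min_le_right _ _).trans (min_le_left _ _)
    linarith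
  have hrr₂ : r < r₂ := by
    have : r ≤ r₂ / 2 := (min_le_right _ _).trans (min_le_right _ _)
    linarith
  -- `N ≥ 2 * κ / r` keeps the touching points where the cutoff is one, `N ≥ ‖p‖` bounds the
  -- linear part.
  set N : ℝ := 1 + ‖p‖ + 2 * κ / r with hN
  have hp0 := norm_nonneg p
  have hκr : 0 < 2 * κ / r := by positivity
  have hN1 : 1 ≤ N := by linarith
  have hN0 : 0 < N := by linarith
  have hNp : ‖p‖ ≤ N := by linarith
  have hNr : 2 * κ / r ≤ N := by linarith
  set q : EuclideanSpace ℝ (Fin d) → ℝ :=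
    fun y => inner ℝ p (y - (x₀ : EuclideanSpace ℝ (Fin d))) + N * ‖y - x₀‖ ^ 2 with hq
  let χ : ContDiffBump (x₀ : EuclideanSpace ℝ (Fin d)) := ⟨r / 2, r, by positivity, by linarith⟩
  set m : ℝ := 2 * B + 1 with hm
  set ft : EuclideanSpace ℝ (Fin d) → ℝ := fun y => χ y * q y + (1 - χ y) * m with hft
  have hqsmooth : ContDiff ℝ ∞ q :=
    (contDiff_const.inner ℝ (contDiff_id.sub contDiff_const)).add
      (contDiff_const.mul ((contDiff_id.sub contDiff_const).norm_sq ℝ))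
  have hχsmooth : ContDiff ℝ ∞ χ := χ.contDiff
  have hsmooth : ContDiff ℝ ∞ ft :=
    (hχsmooth.mul hqsmooth).add ((contDiff_const.sub hχsmooth).mul contDiff_const)
  have hχ0 : ∀ y, 0 ≤ χ y := fun y => χ.nonneg
  have hχ1 : ∀ y, χ y ≤ 1 := fun y => χ.le_one
  have hout : ∀ y, r ≤ dist y (x₀ : EuclideanSpace ℝ (Fin d)) → χ y = 0 := fun y hy =>
    χ.zero_of_le_dist hy
  have hft0 : ft x₀ = 0 := by
    have : χ (x₀ : EuclideanSpace ℝ (Fin d)) = 1 :=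
      χ.one_of_mem_closedBall (Metric.mem_closedBall_self χ.rIn_pos.le)
    simp [hft, this, hq]
  have hwm : ∀ x, w x - m ≤ w x₀ - 1 := fun x => by
    have h1 := (abs_le.1 (hB x)).2
    have h2 := (abs_le.1 (hB x₀)).1
    linarith
  -- the quadratic test function touches within the ball
  have hin : ∀ x : E, dist x x₀ < r →
      w x - q x ≤ w x₀ + κ / 4 * dist x x₀ - N * dist x x₀ ^ 2 := by
    intro x hx
    have h1 := hball (lt_trans (show dist (x : EuclideanSpace ℝ (Fin d)) x₀ < r from hx) hrr₁)
    have h2 := hmax x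
    rw [Real.norm_eq_abs] at h1
    have h3 := (abs_le.1 h1).2
    have h4 : dist x x₀ = ‖(x : EuclideanSpace ℝ (Fin d)) - x₀‖ := by
      rw [Subtype.dist_eq, dist_eq_norm]
    rw [h4]
    simp only [hq]
    linarith
  have hcomb : ∀ x : E, w x - ft x = χ x * (w x - q x) + (1 - χ x) * (w x - m) := by
    intro x
    simp only [hft]
    ring
  have hbound : ∀ x : E, w x - ft x ≤ w x₀ + κ := by
    intro x
    rw [hcomb]
    by_cases hx : dist x x₀ < r
    · have h1 := hin x hx
      have h2 : w x - q x ≤ w x₀ + κ := by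
        have : 0 ≤ N * dist x x₀ ^ 2 := by positivity
        have h' : κ / 4 * dist x x₀ ≤ κ / 4 * 1 :=
          mul_le_mul_of_nonneg_left (hx.le.trans hr1) (by positivity)
        linarith
      have h3 : w x - m ≤ w x₀ + κ := by linarith [hwm x]
      calc χ x * (w x - q x) + (1 - χ x) * (w x - m)
          ≤ χ x * (w x₀ + κ) + (1 - χ x) * (w x₀ + κ) :=
            add_le_add (mul_le_mul_of_nonneg_left h2 (hχ0 x))
              (mul_le_mul_of_nonneg_left h3 (sub_nonneg.2 (hχ1 x)))
        _ = w x₀ + κ := by ring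
    · rw [hout x (not_lt.1 hx)]
      linarith [hwm x]
  have hbdd : BddAbove (Set.range fun x : E => w x - ft x) := by
    refine ⟨w x₀ + κ, ?_⟩
    rintro _ ⟨x, rfl⟩
    exact hbound x
  refine ⟨ft, ⟨⟨Set.univ, isOpen_univ, Set.subset_univ _, hsmooth.contDiffOn⟩,
    Subtype.val ⁻¹' Metric.closedBall (x₀ : EuclideanSpace ℝ (Fin d)) r, ?_, m, ?_⟩, ?_⟩
  · refine hK.of_isClosed_subset (Metric.isClosed_closedBall.preimage continuous_subtype_val) ?_
    intro x hx
    exact hKball (lt_of_le_of_lt (show dist x x₀ ≤ r from hx) hrr₂)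
  · intro x hx
    have : r ≤ dist (x : EuclideanSpace ℝ (Fin d)) x₀ := by
      rw [Set.mem_preimage, Metric.mem_closedBall, not_le] at hx
      exact hx.le
    simp [hft, hout _ this]
  set τ : ℝ := min (1 / 2) (min (κ / 2) (κ ^ 2 / 32 / N)) with hτ
  have hτ0 : 0 < τ := by positivity
  have hτ1 : τ ≤ 1 / 2 := min_le_left _ _
  have hτκ : τ ≤ κ / 2 := (min_le_right _ _).trans (min_le_left _ _)
  have hτN : N * τ ≤ κ ^ 2 / 32 := by
    have : τ ≤ κ ^ 2 / 32 / N := (min_le_right _ _).trans (min_le_right _ _)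
    rwa [le_div_iff₀' hN0] at this
  refine ⟨τ, hτ0, fun x hx => ?_⟩
  have hx0 : w x₀ - τ ≤ w x - ft x := by
    have := le_ciSup hbdd x₀
    simp only [hft0, sub_zero] at this
    linarith
  have hxr : dist x x₀ < r := by
    by_contra hcon
    rw [hcomb, hout x (not_lt.1 hcon)] at hx0
    linarith [hwm x]
  have hxd : N * dist x x₀ < κ / 2 := by
    rw [hcomb] at hx0
    refine quadratic_near_max (a := w x - q x - w x₀) (b := w x - m - w x₀) hN0 hτN hτ1 hτ0
      (hχ0 x) (hχ1 x) hκ ?_ ?_ ?_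
    · linarith [hin x hxr]
    · linarith [hwm x]
    · linarith
  have hd0 : 0 ≤ dist x x₀ := dist_nonneg
  have hxκ : dist x x₀ ≤ κ / 2 := by
    have := mul_le_mul_of_nonneg_right hN1 hd0
    linarith
  have hxr4 : dist x x₀ < r / 2 := by
    have h1 : 2 * κ ≤ N * r := by rwa [div_le_iff₀ hr0] at hNr
    have h2 : N * dist x x₀ < N * (r / 2) := by linarith
    exact lt_of_mul_lt_mul_left h2 hN0.le
  have hχx : ∀ᶠ y in 𝓝 (x : EuclideanSpace ℝ (Fin d)), ft y = q y := by
    have : Metric.ball (x₀ : EuclideanSpace ℝ (Fin d)) (r / 2) ∈ 𝓝 (x : EuclideanSpace ℝ (Fin d)) :=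
      Metric.isOpen_ball.mem_nhds hxr4
    filter_upwards [this] with y hy
    have : χ y = 1 := χ.one_of_mem_closedBall (Metric.ball_subset_closedBall hy)
    simp [hft, this]
  have h4 : dist x x₀ = ‖(x : EuclideanSpace ℝ (Fin d)) - x₀‖ := by
    rw [Subtype.dist_eq, dist_eq_norm]
  refine ⟨by linarith, ?_, ?_⟩
  · have hgr : HasGradientAt ft (p + N • ((2 : ℝ) • ((x : EuclideanSpace ℝ (Fin d)) - x₀))) x :=
      (hasGradientAt_inner_sub_add_norm_sq p (x₀ : EuclideanSpace ℝ (Fin d)) N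
        x).congr_of_eventuallyEq hχx
    rw [hgr.gradient, dist_eq_norm, add_sub_cancel_left, norm_smul, norm_smul, ← h4,
      Real.norm_of_nonneg hN0.le, Real.norm_of_nonneg zero_le_two]
    linarith
  · have h5 : ft x = q x := hχx.self_of_nhds
    have h6 : -(‖p‖ * dist x x₀) ≤ q x := by
      have h7 := (abs_le.1 (abs_real_inner_le_norm p ((x : EuclideanSpace ℝ (Fin d)) - x₀))).1
      have h8 : 0 ≤ N * ‖(x : EuclideanSpace ℝ (Fin d)) - x₀‖ ^ 2 := by positivity
      rw [h4]
      simp only [hq]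
      linarith
    have h9 : ‖p‖ * dist x x₀ ≤ N * dist x x₀ := mul_le_mul_of_nonneg_right hNp hd0
    rw [h5] at hx0
    linarith

/-! ### The effective Hamiltonian and classical touching inequalities -/

section Effective

variable {X P F : Type*} [TopologicalSpace F] [MeasurableSpace F] [OpensMeasurableSpace F]
  {D : Submodule ℝ C(F, ℝ)} {V : X → P → C(F, ℝ)} {A : X → D →ₗ[ℝ] C(F, ℝ)}

/-- The effective Hamiltonian is finite. -/
theorem PrincipalEigenvalueAssumption.coe_toReal [Nonempty F]
    (hEig : PrincipalEigenvalueAssumption D V A) (x : X) (p : P) :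
    ((effectiveHamiltonian V A x p).toReal : EReal) = effectiveHamiltonian V A x p := by
  obtain ⟨g, -, hg⟩ := hEig.solvable x p 1 one_pos
  obtain ⟨z⟩ := ‹Nonempty F›
  refine EReal.coe_toReal ?_ ?_
  · exact ((hg z).2.trans_lt (EReal.coe_lt_top _)).ne
  · exact ((EReal.bot_lt_coe _).trans_le (hg z).1).ne'

theorem PrincipalEigenvalueAssumption.exists_abs_sub_le [Nonempty F]
    (hEig : PrincipalEigenvalueAssumption D V A) (x : X) (p : P) {δ : ℝ} (hδ : 0 < δ) :
    ∃ g : D, (∀ z, 0 < (g : C(F, ℝ)) z) ∧ ∀ z,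
      |V x p z + A x g z / (g : C(F, ℝ)) z - (effectiveHamiltonian V A x p).toReal| ≤ δ := by
  obtain ⟨g, hg0, hg⟩ := hEig.solvable x p δ hδ
  refine ⟨g, hg0, fun z => ?_⟩
  have h := hg z
  rw [← hEig.coe_toReal, EReal.coe_le_coe_iff, EReal.coe_le_coe_iff] at h
  rw [abs_le]
  constructor <;> linarith [h.1, h.2]

theorem PrincipalEigenvalueAssumption.averagedV_sub_le [Nonempty F]
    (hEig : PrincipalEigenvalueAssumption D V A) (x : X) (p : P) {π : ProbabilityMeasure F}
    {i : ℝ} (hi : donskerVaradhan (A x) π = i) :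
    averagedV V x p π - i ≤ (effectiveHamiltonian V A x p).toReal := by
  rw [← EReal.coe_le_coe_iff, hEig.coe_toReal, EReal.coe_sub, ← hi]
  exact le_iSup (fun π : ProbabilityMeasure F =>
    ((averagedV V x p π : ℝ) : EReal) - donskerVaradhan (A x) π) π

theorem PrincipalEigenvalueAssumption.exists_lt_averagedV_sub [Nonempty F]
    (hEig : PrincipalEigenvalueAssumption D V A)
    (hI : ∀ x (π : ProbabilityMeasure F), 0 ≤ donskerVaradhan (A x) π) (x : X) (p : P)
    {δ : ℝ} (hδ : 0 < δ) :
    ∃ (π : ProbabilityMeasure F) (i : ℝ), 0 ≤ i ∧ donskerVaradhan (A x) π = i ∧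
      (effectiveHamiltonian V A x p).toReal - δ ≤ averagedV V x p π - i := by
  have h : (((effectiveHamiltonian V A x p).toReal - δ : ℝ) : EReal) <
      effectiveHamiltonian V A x p := by
    rw [← hEig.coe_toReal, EReal.coe_lt_coe_iff]
    simpa using hδ
  obtain ⟨π, hπ⟩ := lt_iSup_iff.1 h
  have hπ0 := hI x π
  induction hi : donskerVaradhan (A x) π with
  | bot => rw [hi] at hπ0; simp at hπ0
  | top => rw [hi] at hπ; simp at hπ
  | coe i =>
    rw [hi] at hπ hπ0
    rw [← EReal.coe_sub, EReal.coe_lt_coe_iff] at hπ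
    exact ⟨π, i, by exact_mod_cast hπ0, hi, hπ.le⟩

end Effective

section Touching

variable {d : ℕ} {E : Set (EuclideanSpace ℝ (Fin d))}
  {F : Type*} [TopologicalSpace F] [CompactSpace F] {D : Submodule ℝ C(F, ℝ)}
  {V : E → EuclideanSpace ℝ (Fin d) → C(F, ℝ)} {A : E → D →ₗ[ℝ] C(F, ℝ)}

/-- For fixed `g`, the values `V x p z + (A x g / g) z` depend continuously on `(x, p)`, uniformly
in `z`. -/
theorem exists_dist_le_imp_abs_sub_le
    (hV : Continuous fun q : E × EuclideanSpace ℝ (Fin d) => V q.1 q.2)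
    (hA : ∀ g : D, Continuous fun x : E => A x g) {g : D} (hg : ∀ z, 0 < (g : C(F, ℝ)) z)
    {h : E → ℝ} (hh : Continuous h) (x : E) (p : EuclideanSpace ℝ (Fin d)) {δ : ℝ} (hδ : 0 < δ) :
    ∃ κ > 0, ∀ y q, dist y x ≤ κ → dist q p ≤ κ → |h y - h x| ≤ δ ∧
      ∀ z, |(V y q z + A y g z / (g : C(F, ℝ)) z) - (V x p z + A x g z / (g : C(F, ℝ)) z)| ≤ δ := by
  let gi : C(F, ℝ) := ⟨fun z => ((g : C(F, ℝ)) z)⁻¹,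
    (g : C(F, ℝ)).continuous.inv₀ fun z => (hg z).ne'⟩
  have hc : Continuous fun q : E × EuclideanSpace ℝ (Fin d) => (V q.1 q.2 + A q.1 g * gi, h q.1) :=
    (hV.add (((hA g).comp continuous_fst).mul continuous_const)).prodMk (hh.comp continuous_fst)
  obtain ⟨κ, hκ, hball⟩ := Metric.continuousAt_iff.1 (hc.continuousAt (x := (x, p))) δ hδ
  refine ⟨κ / 2, by positivity, fun y q hy hq => ?_⟩
  have hyq : dist (y, q) (x, p) < κ := by
    rw [Prod.dist_eq]
    exact max_lt (by simp only; linarith) (by simp only; linarith)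
  have hd := hball hyq
  rw [Prod.dist_eq] at hd
  refine ⟨(le_max_right _ _).trans hd.le, fun z => ?_⟩
  have h1 := ContinuousMap.dist_apply_le_dist (f := V y q + A y g * gi) (g := V x p + A x g * gi) z
  rw [Real.dist_eq] at h1
  exact h1.trans ((le_max_left _ _).trans hd.le)

variable [MeasurableSpace F] [OpensMeasurableSpace F]

/-- A subsolution for the multivalued Hamiltonian satisfies the classical inequality for the
effective Hamiltonian, with any touching function that is differentiable at the touching point. The
function `φ` that determines the test pair is the logarithm of a near-eigenfunction at `(x₀, p)`,
which makes the dependence on `z` negligible. -/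
theorem IsSubsolution.le_of_touching [Nonempty F] (hEig : PrincipalEigenvalueAssumption D V A)
    (hV : Continuous fun q : E × EuclideanSpace ℝ (Fin d) => V q.1 q.2)
    (hA : ∀ g : D, Continuous fun x : E => A x g)
    {h u : E → ℝ} (hh : Continuous h) {lam : ℝ} (hlam : 0 < lam)
    (hu : IsSubsolution (limitHamiltonian E D V A) lam h u) {x₀ : E}
    (hloc : ∃ K : Set E, IsCompact K ∧ K ∈ 𝓝 x₀) {f : EuclideanSpace ℝ (Fin d) → ℝ}
    {p : EuclideanSpace ℝ (Fin d)} (hf : HasGradientAt f p x₀)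
    (hmax : ∀ x : E, u x - f x ≤ u x₀ - f x₀) :
    u x₀ - h x₀ ≤ lam * (effectiveHamiltonian V A x₀ p).toReal := by
  refine le_of_forall_pos_le_add fun ε hε => ?_
  obtain ⟨δ, hδ, hδε⟩ : ∃ δ > 0, 3 * δ + lam * (2 * δ) ≤ ε := by
    refine ⟨ε / (3 + 2 * lam), by positivity, le_of_eq ?_⟩
    field_simp
  obtain ⟨g, hg0, hg⟩ := hEig.exists_abs_sub_le x₀ p hδ
  obtain ⟨κ, hκ, hnear⟩ := exists_dist_le_imp_abs_sub_le hV hA hg0 hh x₀ p hδ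
  obtain ⟨⟨B, hB⟩, -, hvisc⟩ := hu
  obtain ⟨ft, hft, τ, hτ, htest⟩ := exists_smoothCcc_test hB hloc hf hmax (lt_min hκ hδ)
  obtain ⟨xs, zs, hlim, hlimsup⟩ := hvisc _ _ ⟨ft, hft, fun z => Real.log ((g : C(F, ℝ)) z), g,
    fun z => (Real.exp_log (hg0 z)).symm, rfl, rfl⟩
  have h1 := eventually_lt_of_limsup_lt (hlimsup.trans_lt (EReal.coe_pos.2 hδ))
  have h2 := hlim.eventually (lt_mem_nhds (sub_lt_self _ hτ))
  obtain ⟨n, hn1, hn2⟩ := (h1.and h2).exists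
  obtain ⟨hx1, hx2, hx3⟩ := htest (xs n) hn2.le
  obtain ⟨hh1, hz⟩ := hnear (xs n) _ (hx1.trans (min_le_left _ _)) (hx2.trans (min_le_left _ _))
  have hz1 := hz (zs n)
  have hz2 := hg (zs n)
  rw [EReal.coe_lt_coe_iff] at hn1
  simp only [Real.exp_neg, Real.exp_log (hg0 _)] at hn1
  rw [inv_mul_eq_div] at hn1
  have h3 := (abs_le.1 hh1).2
  have h4 : V (xs n) (gradient ft (xs n)) (zs n) + A (xs n) g (zs n) / (g : C(F, ℝ)) (zs n) ≤
      (effectiveHamiltonian V A x₀ p).toReal + 2 * δ := by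
    linarith [(abs_le.1 hz1).2, (abs_le.1 hz2).2]
  have h5 := mul_le_mul_of_nonneg_left h4 hlam.le
  have h6 : min κ δ ≤ δ := min_le_right _ _
  linarith

/-- The counterpart of `IsSubsolution.le_of_touching` for supersolutions. -/
theorem IsSupersolution.le_of_touching [Nonempty F] (hEig : PrincipalEigenvalueAssumption D V A)
    (hV : Continuous fun q : E × EuclideanSpace ℝ (Fin d) => V q.1 q.2)
    (hA : ∀ g : D, Continuous fun x : E => A x g)
    {h v : E → ℝ} (hh : Continuous h) {lam : ℝ} (hlam : 0 < lam)
    (hv : IsSupersolution (limitHamiltonian E D V A) lam h v) {x₀ : E}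
    (hloc : ∃ K : Set E, IsCompact K ∧ K ∈ 𝓝 x₀) {f : EuclideanSpace ℝ (Fin d) → ℝ}
    {p : EuclideanSpace ℝ (Fin d)} (hf : HasGradientAt f p x₀)
    (hmin : ∀ x : E, v x₀ - f x₀ ≤ v x - f x) :
    lam * (effectiveHamiltonian V A x₀ p).toReal ≤ v x₀ - h x₀ := by
  refine le_of_forall_pos_le_add fun ε hε => ?_
  obtain ⟨δ, hδ, hδε⟩ : ∃ δ > 0, 3 * δ + lam * (2 * δ) ≤ ε := by
    refine ⟨ε / (3 + 2 * lam), by positivity, le_of_eq ?_⟩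
    field_simp
  obtain ⟨g, hg0, hg⟩ := hEig.exists_abs_sub_le x₀ p hδ
  obtain ⟨κ, hκ, hnear⟩ := exists_dist_le_imp_abs_sub_le hV hA hg0 hh x₀ p hδ
  obtain ⟨⟨B, hB⟩, -, hvisc⟩ := hv
  obtain ⟨ft, ⟨⟨U, hU, hEU, hftU⟩, K, hK, c, hc⟩, τ, hτ, htest⟩ :=
    exists_smoothCcc_test (w := fun x => -v x) (B := B) (fun x => by rw [abs_neg]; exact hB x)
      hloc (hasGradientAt_neg hf) (fun x => by linarith [hmin x]) (lt_min hκ hδ)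
  have hft' : IsSmoothCcc E fun x => -ft x :=
    ⟨⟨U, hU, hEU, hftU.neg⟩, K, hK, -c, fun x hx => congrArg _ (hc x hx)⟩
  obtain ⟨xs, zs, hlim, hliminf⟩ := hvisc _ _ ⟨fun x => -ft x, hft',
    fun z => Real.log ((g : C(F, ℝ)) z), g, fun z => (Real.exp_log (hg0 z)).symm, rfl, rfl⟩
  have hsup : (⨆ y : E, (-v y - ft y)) = -⨅ y : E, (v y - -ft y) := by
    rw [iInf, Real.sInf_def, neg_neg, Set.neg_range, ← iSup]
    congr 1 with y
    ring
  have h1 := eventually_lt_of_lt_liminf (lt_of_lt_of_le (EReal.coe_lt_coe_iff.2 (neg_lt_zero.2 hδ))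
    hliminf)
  have h2 := hlim.eventually (gt_mem_nhds (lt_add_of_pos_right _ hτ))
  obtain ⟨n, hn1, hn2⟩ := (h1.and h2).exists
  obtain ⟨hx1, hx2, hx3⟩ := htest (xs n) (by rw [hsup]; linarith)
  have hgrad : gradient (fun x => -ft x) (xs n) = -gradient ft (xs n) := by
    simp only [gradient, fderiv_fun_neg, map_neg]
  rw [← dist_neg_neg, neg_neg, ← hgrad] at hx2
  obtain ⟨hh1, hz⟩ := hnear (xs n) _ (hx1.trans (min_le_left _ _)) (hx2.trans (min_le_left _ _))
  have hz1 := hz (zs n)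
  have hz2 := hg (zs n)
  rw [EReal.coe_lt_coe_iff] at hn1
  simp only [Real.exp_neg, Real.exp_log (hg0 _)] at hn1
  rw [inv_mul_eq_div] at hn1
  have h3 := (abs_le.1 hh1).1
  have h4 : (effectiveHamiltonian V A x₀ p).toReal - 2 * δ ≤
      V (xs n) (gradient (fun x => -ft x) (xs n)) (zs n) +
        A (xs n) g (zs n) / (g : C(F, ℝ)) (zs n) := by
    linarith [(abs_le.1 hz1).1, (abs_le.1 hz2).1]
  have h5 := mul_le_mul_of_nonneg_left h4 hlam.le
  have h6 : min κ δ ≤ δ := min_le_right _ _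
  linarith

end Touching

/-! ### Regularity of the averaged Hamiltonian and of the cost functional -/

section Averaged

variable {X P F : Type*} [TopologicalSpace F] [CompactSpace F] [MeasurableSpace F]
  [OpensMeasurableSpace F]

theorem integrable_continuousMap (W : C(F, ℝ)) (π : ProbabilityMeasure F) :
    Integrable W (π : Measure F) :=
  BoundedContinuousFunction.integrable _ (BoundedContinuousFunction.mkOfCompact W)

theorem continuous_integral_continuousMap :
    Continuous fun q : C(F, ℝ) × ProbabilityMeasure F => ∫ z, q.1 z ∂(q.2 : Measure F) := by
  refine continuous_iff_continuousAt.2 fun q₀ => ?_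
  have h1 : Tendsto (fun q : C(F, ℝ) × ProbabilityMeasure F => ∫ z, q₀.1 z ∂(q.2 : Measure F))
      (𝓝 q₀) (𝓝 (∫ z, q₀.1 z ∂(q₀.2 : Measure F))) :=
    ((ProbabilityMeasure.continuous_integral_boundedContinuousFunction
      (BoundedContinuousFunction.mkOfCompact q₀.1)).comp continuous_snd).continuousAt
  have h2 : Tendsto (fun q : C(F, ℝ) × ProbabilityMeasure F => dist q.1 q₀.1) (𝓝 q₀) (𝓝 0) := by
    have := (continuous_fst.dist (continuous_const (y := q₀.1))).tendsto
      (x := q₀) (f := fun q : C(F, ℝ) × ProbabilityMeasure F => dist q.1 q₀.1)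
    simpa using this
  refine tendsto_of_tendsto_of_dist h1 (squeeze_zero (fun _ => dist_nonneg) (fun q => ?_) h2)
  rw [dist_eq_norm, ← integral_sub (integrable_continuousMap _ _) (integrable_continuousMap _ _)]
  refine (norm_integral_le_of_norm_le_const (C := dist q.1 q₀.1)
    (Eventually.of_forall fun z => ?_)).trans (by simp)
  rw [← dist_eq_norm, dist_comm]
  exact ContinuousMap.dist_apply_le_dist z

theorem continuous_averagedV [TopologicalSpace X] [TopologicalSpace P] {V : X → P → C(F, ℝ)}
    (hV : Continuous fun q : X × P => V q.1 q.2) :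
    Continuous fun q : (X × P) × ProbabilityMeasure F => averagedV V q.1.1 q.1.2 q.2 :=
  continuous_integral_continuousMap.comp ((hV.comp continuous_fst).prodMk continuous_snd)

variable {V : X → P → C(F, ℝ)}

theorem averagedV_le {x : X} {p : P} {c : ℝ} (h : ∀ z, V x p z ≤ c) (π : ProbabilityMeasure F) :
    averagedV V x p π ≤ c :=
  (integral_mono (integrable_continuousMap (V x p) π) (integrable_const c) h).trans (by simp)

theorem exists_le_of_averagedV_le {x : X} {p : P} {c : ℝ} {π : ProbabilityMeasure F}
    (h : averagedV V x p π ≤ c) : ∃ z, V x p z ≤ c := by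
  obtain ⟨z, hz⟩ := exists_le_integral (μ := (π : Measure F)) (integrable_continuousMap (V x p) π)
  exact ⟨z, hz.trans h⟩

theorem convexOn_averagedV [AddCommGroup P] [Module ℝ P] {x : X}
    (h : ∀ z, ConvexOn ℝ Set.univ fun p => V x p z) (π : ProbabilityMeasure F) :
    ConvexOn ℝ Set.univ fun p => averagedV V x p π := by
  refine ⟨convex_univ, fun p _ q _ a b ha hb hab => ?_⟩
  simp only [averagedV, smul_eq_mul]
  rw [← integral_const_mul, ← integral_const_mul, ← integral_add
    ((integrable_continuousMap _ _).const_mul _) ((integrable_continuousMap _ _).const_mul _)]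
  exact integral_mono (integrable_continuousMap _ _)
    (((integrable_continuousMap _ _).const_mul _).add ((integrable_continuousMap _ _).const_mul _))
    fun z => (h z).2 (Set.mem_univ p) (Set.mem_univ q) ha hb hab

end Averaged

/-- For a fixed `π` with `I x π < ∞`, the function `I · π` is sequentially continuous at `x`. The
local bound makes `I · π` bounded near `x`, and this puts `π` into the sublevel sets on which the
family is equicontinuous. -/
theorem RegularI.eventually_abs_toReal_sub_le {X Q : Type*} [PseudoMetricSpace X]
    [TopologicalSpace Q] {I : X → Q → EReal} (hI : RegularI I) {x : X} {π : Q} {i : ℝ}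
    (hi : I x π = i) {y : ℕ → X} (hy : Tendsto y atTop (𝓝 x)) {ε : ℝ} (hε : 0 < ε) :
    ∀ᶠ n in atTop, ∃ j : ℝ, I (y n) π = j ∧ |j - i| ≤ ε := by
  obtain ⟨U, hU, hxU, M, C₁, C₂, hM, -, -, hUI⟩ := hI.finiteness x {π} isCompact_singleton
  set M' : ℝ := max M (C₁ * i + C₂) with hM'
  have hle : ∀ y ∈ U, I y π ≤ (M' : EReal) := by
    intro y hy
    have h := hUI y hy π rfl
    rw [hi] at h
    rwa [hM', EReal.coe_strictMono.monotone.map_max, EReal.coe_add, EReal.coe_mul]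
  have hcoe : ∀ y ∈ U, ((I y π).toReal : EReal) = I y π := fun y hy =>
    EReal.coe_toReal ((hle y hy).trans_lt (EReal.coe_lt_top _)).ne
      ((EReal.bot_lt_zero).trans_le (hI.nonneg y π)).ne'
  obtain ⟨n₀, hn₀⟩ := eventually_atTop.1 (hy.eventually (hU.mem_nhds hxU))
  have hy' : Tendsto (fun n => y (n + n₀)) atTop (𝓝 x) := (tendsto_add_atTop_iff_nat n₀).2 hy
  have hK := hy'.isCompact_insert_range
  set K := insert x (Set.range fun n => y (n + n₀)) with hKdef
  have hKU : K ⊆ U := by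
    rintro _ (rfl | ⟨n, rfl⟩)
    · exact hxU
    · exact hn₀ _ (Nat.le_add_left _ _)
  obtain ⟨δ, hδ, hequi⟩ := hI.equicontinuous K hK M' (hM.trans (le_max_left _ _)) ε hε
  have hmem : π ∈ interSublevel I K M' := Set.mem_iInter₂.2 fun y hy => hle y (hKU hy)
  filter_upwards [hy.eventually (Metric.closedBall_mem_nhds x hδ), eventually_ge_atTop n₀]
    with n hn1 hn2
  have hyK : y n ∈ K := Or.inr ⟨n - n₀, by simp [Nat.sub_add_cancel hn2]⟩
  refine ⟨_, (hcoe _ (hKU hyK)).symm, ?_⟩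
  have := hequi π hmem (y n) hyK x (Or.inl rfl) hn1
  rwa [hi, EReal.toReal_coe] at this

/-! ### Penalization functions -/

theorem eq_of_mapClusterPt_of_tendsto {X ι : Type*} [TopologicalSpace X] [T2Space X]
    {l : Filter ι} {u : ι → X} {a b : X} (ha : MapClusterPt a l u) (hb : Tendsto u l (𝓝 b)) :
    a = b :=
  have : (𝓝 a ⊓ 𝓝 b).NeBot := ClusterPt.mono ha hb
  eq_of_nhds_neBot this

section Penalization

variable {d : ℕ} {E : Set (EuclideanSpace ℝ (Fin d))}

theorem IsCk.hasGradientAt {f : EuclideanSpace ℝ (Fin d) → ℝ} (hf : IsCk 1 E f) (x : E) :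
    HasGradientAt f (gradient f x) x := by
  obtain ⟨U, hU, hEU, hfU⟩ := hf
  exact (hfU.differentiableOn (by simp)).hasGradientAt (hU.mem_nhds (hEU x.2))

theorem IsCk.continuous {f : EuclideanSpace ℝ (Fin d) → ℝ} (hf : IsCk 1 E f) :
    Continuous fun x : E => f x := by
  obtain ⟨U, -, hEU, hfU⟩ := hf
  exact continuousOn_iff_continuous_domRestrict.1 (hfU.continuousOn.mono hEU)

variable {Ψ : EuclideanSpace ℝ (Fin d) → EuclideanSpace ℝ (Fin d) → ℝ}

theorem IsPenalization.continuous (hΨ : IsPenalization E Ψ) :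
    Continuous fun q : E × E => Ψ q.1 q.2 := by
  obtain ⟨U, -, hEU, hfU⟩ := hΨ.isC1
  exact hfU.continuousOn.comp_continuous
    (f := fun q : E × E => ((q.1 : EuclideanSpace ℝ (Fin d)), (q.2 : EuclideanSpace ℝ (Fin d))))
    (by fun_prop) fun q => hEU ⟨q.1.2, q.2.2⟩

theorem IsPenalization.hasFDerivAt_left (hΨ : IsPenalization E Ψ) (x y : E) :
    HasFDerivAt (fun w => Ψ w y) ((fderiv ℝ (Function.uncurry Ψ) (x, y)).comp
      (ContinuousLinearMap.inl ℝ (EuclideanSpace ℝ (Fin d)) (EuclideanSpace ℝ (Fin d))))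
      (x : EuclideanSpace ℝ (Fin d)) := by
  obtain ⟨U, hU, hEU, hfU⟩ := hΨ.isC1
  have h := ((hfU.differentiableOn (by simp)).differentiableAt
    (hU.mem_nhds (hEU (Set.mk_mem_prod x.2 y.2)))).hasFDerivAt
  exact HasFDerivAt.comp (f := fun w : EuclideanSpace ℝ (Fin d) =>
    (w, (y : EuclideanSpace ℝ (Fin d)))) _ h (hasFDerivAt_prodMk_left _ _)

theorem IsPenalization.hasGradientAt_left (hΨ : IsPenalization E Ψ) (x y : E) :
    HasGradientAt (fun w => Ψ w y) (gradient (fun w => Ψ w y) (x : EuclideanSpace ℝ (Fin d))) x :=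
  (hΨ.hasFDerivAt_left x y).differentiableAt.hasGradientAt

theorem IsPenalization.hasGradientAt_right (hΨ : IsPenalization E Ψ) (x y : E) :
    HasGradientAt (fun w => Ψ x w) (gradient (fun w => Ψ x w) (y : EuclideanSpace ℝ (Fin d)))
      y := by
  obtain ⟨U, hU, hEU, hfU⟩ := hΨ.isC1
  have h := ((hfU.differentiableOn (by simp)).differentiableAt
    (hU.mem_nhds (hEU (Set.mk_mem_prod x.2 y.2)))).hasFDerivAt
  exact (HasFDerivAt.comp (f := fun w : EuclideanSpace ℝ (Fin d) =>
    ((x : EuclideanSpace ℝ (Fin d)), w)) _ h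
    (hasFDerivAt_prodMk_right _ _)).differentiableAt.hasGradientAt

theorem IsPenalization.continuous_gradient_left (hΨ : IsPenalization E Ψ) :
    Continuous fun q : E × E =>
      gradient (fun w => Ψ w q.2) (q.1 : EuclideanSpace ℝ (Fin d)) := by
  have h1 : Continuous fun q : E × E => fderiv ℝ (Function.uncurry Ψ) (q.1, q.2) := by
    obtain ⟨U, hU, hEU, hfU⟩ := hΨ.isC1
    exact (hfU.continuousOn_fderiv_of_isOpen hU le_rfl).comp_continuous
      (f := fun q : E × E => ((q.1 : EuclideanSpace ℝ (Fin d)), (q.2 : EuclideanSpace ℝ (Fin d))))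
      (by fun_prop) fun q => hEU ⟨q.1.2, q.2.2⟩
  have h2 : (fun q : E × E => gradient (fun w => Ψ w q.2) (q.1 : EuclideanSpace ℝ (Fin d))) =
      fun q => (InnerProductSpace.toDual ℝ (EuclideanSpace ℝ (Fin d))).symm
        ((fderiv ℝ (Function.uncurry Ψ) (q.1, q.2)).comp (ContinuousLinearMap.inl ℝ _ _)) :=
    funext fun q => by rw [gradient, (hΨ.hasFDerivAt_left q.1 q.2).fderiv]
  rw [h2]
  exact (LinearIsometryEquiv.continuous _).comp (h1.clm_comp continuous_const)

theorem IsPenalization.self_eq_zero (hΨ : IsPenalization E Ψ) (x : E) : Ψ x x = 0 :=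
  (hΨ.eq_zero_iff x x.2 x x.2).2 rfl

theorem IsPenalization.tendsto_of_tendsto_zero (hΨ : IsPenalization E Ψ) {K : Set E}
    (hK : IsCompact K) {x : E} {y : ℕ → E} (hy : ∀ n, y n ∈ K)
    (h : Tendsto (fun n => Ψ x (y n)) atTop (𝓝 0)) : Tendsto y atTop (𝓝 x) := by
  refine hK.tendsto_nhds_of_unique_mapClusterPt (Eventually.of_forall hy) fun z _ hz => ?_
  have h1 : MapClusterPt (Ψ x z) atTop fun n => Ψ x (y n) :=
    hz.continuousAt_comp (f := fun w : E => Ψ x w)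
      (hΨ.continuous.comp (continuous_const.prodMk continuous_id)).continuousAt
  have h2 : Ψ x z = 0 := eq_of_mapClusterPt_of_tendsto h1 h
  exact Subtype.ext ((hΨ.eq_zero_iff x x.2 z z.2).1 h2).symm

/-- The continuity estimate for a single sequence of variables. The condition on cluster points
follows from `α k * Ψ (x k) (y k) → 0`. -/
theorem ContinuityEstimate.frequently_sub_lt {Q : Type*} [TopologicalSpace Q]
    {G : E → EuclideanSpace ℝ (Fin d) → Q → ℝ} (hG : ContinuityEstimate G Ψ)
    (hΨ : IsPenalization E Ψ) {α : ℕ → ℝ} {x y : ℕ → E} {π : ℕ → Q} {K : Set E} {K' : Set Q}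
    (hK : IsCompact K) (hK' : IsCompact K') (hα0 : ∀ k, 0 < α k) (hα : Tendsto α atTop atTop)
    (hx : ∀ k, x k ∈ K) (hy : ∀ k, y k ∈ K) (hπ : ∀ k, π k ∈ K')
    (hpen : Tendsto (fun k => α k * Ψ (x k) (y k)) atTop (𝓝 0)) {a b : ℝ}
    (hR : ∀ k, rightValue G Ψ (α k) (x k) (y k) (π k) ≤ a)
    (hL : ∀ k, b ≤ leftValue G Ψ (α k) (x k) (y k) (π k)) {δ : ℝ} (hδ : 0 < δ) :
    ∃ᶠ k in atTop, leftValue G Ψ (α k) (x k) (y k) (π k) -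
      rightValue G Ψ (α k) (x k) (y k) (π k) < δ := by
  have hΨ0 : Tendsto (fun k => Ψ (x k) (y k)) atTop (𝓝 0) := by
    refine squeeze_zero' (Eventually.of_forall fun k => hΨ.nonneg _ (x k).2 _ (y k).2) ?_ hpen
    filter_upwards [hα.eventually_ge_atTop 1] with k hk
    exact le_mul_of_one_le_left (hΨ.nonneg _ (x k).2 _ (y k).2) hk
  have hfund : IsFundamental G Ψ (fun _ => α) (fun _ => x) (fun _ => y) (fun _ => π) :=
    { pos := fun _ _ => hα0
      tendsto_atTop := fun _ _ => hα
      compact := fun _ _ => ⟨K, K', hK, hK', fun k => ⟨hx k, hy k, hπ k⟩⟩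
      penalty := fun _ _ => hpen
      cluster := fun _ _ q hq => by
        have h1 : MapClusterPt (Ψ q.1 q.2) atTop fun k => Ψ (x k) (y k) :=
          hq.continuousAt_comp (f := fun q : E × E => Ψ q.1 q.2) hΨ.continuous.continuousAt
        exact eq_of_mapClusterPt_of_tendsto h1 hΨ0
      bddAbove := fun _ _ => ⟨a, by rintro _ ⟨k, rfl⟩; exact hR k⟩
      bddBelow := fun _ _ => ⟨b, by rintro _ ⟨k, rfl⟩; exact hL k⟩ }
  have h := hG _ _ _ _ hfund 1 one_pos
  have h2 := frequently_lt_of_liminf_lt (b := (δ : EReal)) (by isBoundedDefault)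
    (h.trans_lt (EReal.coe_pos.2 hδ))
  exact h2.mono fun k hk => EReal.coe_lt_coe_iff.1 hk

/-- When `Q` is compact, the continuity estimate gives, by contradiction, a uniform bound: if the
penalty is small and `α` is large, an upper bound on the right value bounds the left value. -/
theorem ContinuityEstimate.exists_leftValue_le {Q : Type*} [TopologicalSpace Q] [CompactSpace Q]
    {G : E → EuclideanSpace ℝ (Fin d) → Q → ℝ} (hG : ContinuityEstimate G Ψ)
    (hΨ : IsPenalization E Ψ) {K : Set E} (hK : IsCompact K) (c : ℝ) :
    ∃ η > 0, ∃ a > 0, ∀ α ≥ a, ∀ x ∈ K, ∀ y ∈ K, α * Ψ x y ≤ η → ∀ π,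
      rightValue G Ψ α x y π ≤ c → leftValue G Ψ α x y π ≤ c + 1 := by
  by_contra! hcon
  have hpos : ∀ n : ℕ, (0 : ℝ) < 1 / ((n : ℝ) + 1) := fun n => by positivity
  have hpos' : ∀ n : ℕ, (0 : ℝ) < (n : ℝ) + 1 := fun n => by positivity
  choose α hα x hx y hy hη π hR hL using fun n : ℕ => hcon _ (hpos n) _ (hpos' n)
  have hα0 : ∀ n, 0 < α n := fun n => (hpos' n).trans_le (hα n)
  have hαtop : Tendsto α atTop atTop :=
    tendsto_atTop_mono hα (tendsto_atTop_add_const_right _ _ tendsto_natCast_atTop_atTop)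
  have hpen : Tendsto (fun k => α k * Ψ (x k) (y k)) atTop (𝓝 0) :=
    squeeze_zero (fun k => mul_nonneg (hα0 k).le (hΨ.nonneg _ (x k).2 _ (y k).2)) hη
      tendsto_one_div_add_atTop_nhds_zero_nat
  obtain ⟨k, hk⟩ := (hG.frequently_sub_lt hΨ hK isCompact_univ hα0 hαtop hx hy
    (fun k => Set.mem_univ (π k)) hpen hR (fun k => (hL k).le) one_pos).exists
  linarith [hR k, hL k]

end Penalization

/-! ### The perturbed sub- and supersolution -/

/-- The subsolution, pushed down by the containment function and rescaled. -/
noncomputable def perturbedSub {d : ℕ} {E : Set (EuclideanSpace ℝ (Fin d))}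
    (Υ : EuclideanSpace ℝ (Fin d) → ℝ) (ε : ℝ) (u : E → ℝ) (x : E) : ℝ :=
  (u x - ε * Υ x) / (1 - ε)

/-- The supersolution, pushed up by the containment function and rescaled. -/
noncomputable def perturbedSuper {d : ℕ} {E : Set (EuclideanSpace ℝ (Fin d))}
    (Υ : EuclideanSpace ℝ (Fin d) → ℝ) (ε : ℝ) (v : E → ℝ) (y : E) : ℝ :=
  (v y + ε * Υ y) / (1 + ε)

/-- The data fixed during the doubling of variables: the hypotheses on `V`, `A` and the two
solutions, a penalization function `Ψ` satisfying the continuity estimate, a containment function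
`Υ` with `V_{x,∇Υ(x)} ≤ c` for some `c ≥ 0`, a common bound `B` for the functions involved, and the
strength `ε ∈ (0, 1)` of the perturbation. -/
structure DoublingSetting {d : ℕ} (E : Set (EuclideanSpace ℝ (Fin d)))
    {F : Type*} [TopologicalSpace F] [CompactSpace F] [MeasurableSpace F] [OpensMeasurableSpace F]
    (D : Submodule ℝ C(F, ℝ)) (V : E → EuclideanSpace ℝ (Fin d) → C(F, ℝ))
    (A : E → D →ₗ[ℝ] C(F, ℝ)) (Ψ : EuclideanSpace ℝ (Fin d) → EuclideanSpace ℝ (Fin d) → ℝ)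
    (Υ : EuclideanSpace ℝ (Fin d) → ℝ) (lam : ℝ) (h₁ h₂ u v : E → ℝ) (B c ε : ℝ) : Prop where
  eig : PrincipalEigenvalueAssumption D V A
  regV : RegularV E V
  contA : ∀ g : D, Continuous fun x : E => A x g
  regI : RegularI fun (x : E) (π : ProbabilityMeasure F) => donskerVaradhan (A x) π
  pen : IsPenalization E Ψ
  estimate : ContinuityEstimate (averagedV V) Ψ
  containment : IsContainment E V Υ
  V_le : ∀ (x : E) (z : F), V x (gradient Υ (x : EuclideanSpace ℝ (Fin d))) z ≤ c
  c_nonneg : 0 ≤ c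
  lam_pos : 0 < lam
  cont_h₁ : Continuous h₁
  cont_h₂ : Continuous h₂
  sub : IsSubsolution (limitHamiltonian E D V A) lam h₁ u
  super : IsSupersolution (limitHamiltonian E D V A) lam h₂ v
  h₁_le : ∀ x, |h₁ x| ≤ B
  h₂_le : ∀ x, |h₂ x| ≤ B
  u_le : ∀ x, |u x| ≤ B
  v_le : ∀ x, |v x| ≤ B
  eps_pos : 0 < ε
  eps_lt : ε < 1

namespace DoublingSetting

variable {d : ℕ} {E : Set (EuclideanSpace ℝ (Fin d))}
  {F : Type*} [TopologicalSpace F] [CompactSpace F] [MeasurableSpace F] [OpensMeasurableSpace F]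
  {D : Submodule ℝ C(F, ℝ)} {V : E → EuclideanSpace ℝ (Fin d) → C(F, ℝ)}
  {A : E → D →ₗ[ℝ] C(F, ℝ)} {Ψ : EuclideanSpace ℝ (Fin d) → EuclideanSpace ℝ (Fin d) → ℝ}
  {Υ : EuclideanSpace ℝ (Fin d) → ℝ} {lam : ℝ} {h₁ h₂ u v : E → ℝ} {B c ε : ℝ}

/-- `F` is nonempty, since there is a probability measure on it. -/
theorem nonempty (S : DoublingSetting E D V A Ψ Υ lam h₁ h₂ u v B c ε) (x : E) : Nonempty F := by
  obtain ⟨π, -⟩ := S.regI.exists_zero x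
  exact π.nonempty

theorem exists_compact_nhds (S : DoublingSetting E D V A Ψ Υ lam h₁ h₂ u v B c ε) (x : E) :
    ∃ K : Set E, IsCompact K ∧ K ∈ 𝓝 x :=
  ⟨_, S.containment.compact_sublevel (Υ x + 1),
    S.containment.isC1.continuous.continuousAt.eventually (Iic_mem_nhds (lt_add_one _))⟩

theorem upperSemicontinuous_perturbedSub (S : DoublingSetting E D V A Ψ Υ lam h₁ h₂ u v B c ε) :
    UpperSemicontinuous (perturbedSub Υ ε u) := by
  have h1 : UpperSemicontinuous fun x : E => u x + -(ε * Υ x) :=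
    S.sub.2.1.add (S.containment.isC1.continuous.const_mul ε).neg.upperSemicontinuous
  have h2 : 0 < 1 - ε := sub_pos.2 S.eps_lt
  exact (continuous_id.div_const (1 - ε)).comp_upperSemicontinuous h1
    fun a b hab => div_le_div_of_nonneg_right hab h2.le

theorem lowerSemicontinuous_perturbedSuper (S : DoublingSetting E D V A Ψ Υ lam h₁ h₂ u v B c ε) :
    LowerSemicontinuous (perturbedSuper Υ ε v) := by
  have h1 : LowerSemicontinuous fun x : E => v x + ε * Υ x :=
    S.super.2.1.add (S.containment.isC1.continuous.const_mul ε).lowerSemicontinuous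
  have h2 : 0 < 1 + ε := by linarith [S.eps_pos]
  exact (continuous_id.div_const (1 + ε)).comp_lowerSemicontinuous h1
    fun a b hab => div_le_div_of_nonneg_right hab h2.le

theorem bound_nonneg (S : DoublingSetting E D V A Ψ Υ lam h₁ h₂ u v B c ε) (x : E) : 0 ≤ B :=
  (abs_nonneg _).trans (S.u_le x)

theorem neg_le_perturbedSuper (S : DoublingSetting E D V A Ψ Υ lam h₁ h₂ u v B c ε) (y : E) :
    -B ≤ perturbedSuper Υ ε v y := by
  have h2 : 0 < 1 + ε := by linarith [S.eps_pos]
  have h3 := S.containment.nonneg y y.2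
  have h4 := mul_nonneg S.eps_pos.le h3
  have h5 := mul_nonneg S.eps_pos.le (S.bound_nonneg y)
  rw [perturbedSuper, le_div_iff₀ h2]
  linarith [(abs_le.1 (S.v_le y)).1]

/-- The supersolution inequality at a minimum point `y` of the perturbed supersolution plus a
penalty, for an arbitrary measure `π`. The momentum `-(s ∇Ψ)` is a convex combination of the
momentum of the touching function and of `∇Υ`, so the perturbation by `Υ` costs at most `ε * c`. -/
theorem super_ineq (S : DoublingSetting E D V A Ψ Υ lam h₁ h₂ u v B c ε) {x y : E} {s : ℝ}
    (hmin : ∀ y' : E, perturbedSuper Υ ε v y + s * Ψ x y ≤ perturbedSuper Υ ε v y' + s * Ψ x y')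
    {π : ProbabilityMeasure F} {i : ℝ} (hi : donskerVaradhan (A y) π = i) :
    lam * (rightValue (averagedV V) Ψ s x y π - i - ε * c) ≤ (v y - h₂ y) / (1 + ε) := by
  have := S.nonempty y
  have hε := S.eps_pos
  have hε1 : 0 < 1 + ε := by linarith
  have hi0 : 0 ≤ i := by
    have := S.regI.nonneg y π
    simp only [hi] at this
    exact_mod_cast this
  have hgrad := hasGradientAt_neg (hasGradientAt_add
    (hasGradientAt_const_mul (1 + ε) (hasGradientAt_const_mul s (S.pen.hasGradientAt_right x y)))
    (hasGradientAt_const_mul ε (S.containment.isC1.hasGradientAt y)))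
  have htouch := S.super.le_of_touching S.eig S.regV.continuous S.contA S.cont_h₂ S.lam_pos
    (S.exists_compact_nhds y) hgrad (fun y' => by
      have h := mul_le_mul_of_nonneg_left (hmin y') hε1.le
      simp only [perturbedSuper, mul_add, mul_div_cancel₀ _ hε1.ne'] at h
      linarith)
  have hle := S.eig.averagedV_sub_le y (-((1 + ε) • s • gradient (fun w => Ψ x w)
    (y : EuclideanSpace ℝ (Fin d)) + ε • gradient Υ (y : EuclideanSpace ℝ (Fin d)))) hi
  have hconv := (convexOn_averagedV (S.regV.convex y) π).2
    (Set.mem_univ (-((1 + ε) • s • gradient (fun w => Ψ x w)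
    (y : EuclideanSpace ℝ (Fin d)) + ε • gradient Υ (y : EuclideanSpace ℝ (Fin d)))))
    (Set.mem_univ (gradient Υ (y : EuclideanSpace ℝ (Fin d))))
    (show 0 ≤ 1 / (1 + ε) by positivity) (show 0 ≤ ε / (1 + ε) by positivity)
    (by field_simp)
  have hp : (1 / (1 + ε)) • (-((1 + ε) • s • gradient (fun w => Ψ x w)
      (y : EuclideanSpace ℝ (Fin d)) + ε • gradient Υ (y : EuclideanSpace ℝ (Fin d)))) +
      (ε / (1 + ε)) • gradient Υ (y : EuclideanSpace ℝ (Fin d)) =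
      -(s • gradient (fun w => Ψ x w) (y : EuclideanSpace ℝ (Fin d))) := by
    rw [smul_neg, smul_add, smul_smul, smul_smul, one_div_mul_cancel hε1.ne', one_mul,
      smul_smul, one_div_mul_eq_div]
    abel
  rw [hp] at hconv
  have hΥ := averagedV_le (S.V_le y) π
  simp only [smul_eq_mul] at hconv
  rw [rightValue]
  set R := averagedV V y (-(s • gradient (fun w => Ψ x w) (y : EuclideanSpace ℝ (Fin d)))) π
  set T := averagedV V y (-((1 + ε) • s • gradient (fun w => Ψ x w)
    (y : EuclideanSpace ℝ (Fin d)) + ε • gradient Υ (y : EuclideanSpace ℝ (Fin d)))) π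
  have h1 : R * (1 + ε) ≤ T + ε * c := by
    have h2 := mul_le_mul_of_nonneg_right hconv hε1.le
    have h3 : (1 / (1 + ε) * T + ε / (1 + ε) * averagedV V y (gradient Υ ↑y) π) * (1 + ε) =
        T + ε * averagedV V y (gradient Υ ↑y) π := by field_simp
    rw [h3] at h2
    exact h2.trans (by gcongr)
  rw [le_div_iff₀ hε1]
  refine le_trans ?_ htouch
  rw [mul_assoc]
  refine mul_le_mul_of_nonneg_left (le_trans ?_ hle) S.lam_pos.le
  have h4 : 0 ≤ i * ε := mul_nonneg hi0 hε.le
  have h5 : 0 ≤ ε * c * ε := by have := S.c_nonneg; positivity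
  linarith

/-- The subsolution inequality at a maximum point of the perturbed subsolution minus a convex
combination of penalties: one measure `π`, nearly optimal at `x`, bounds the left-hand side by the
same convex combination of the left values. -/
theorem sub_ineq (S : DoublingSetting E D V A Ψ Υ lam h₁ h₂ u v B c ε) {x : E} {s : Finset ℕ}
    {w a : ℕ → ℝ} {y : ℕ → E} (hw0 : ∀ k ∈ s, 0 ≤ w k) (hw1 : ∑ k ∈ s, w k = 1)
    (hmax : ∀ x' : E, perturbedSub Υ ε u x' - ∑ k ∈ s, w k * (a k * Ψ x' (y k)) ≤
      perturbedSub Υ ε u x - ∑ k ∈ s, w k * (a k * Ψ x (y k))) {δ : ℝ} (hδ : 0 < δ) :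
    ∃ (π : ProbabilityMeasure F) (i : ℝ), 0 ≤ i ∧ donskerVaradhan (A x) π = i ∧
      (u x - h₁ x) / (1 - ε) ≤
        lam * (∑ k ∈ s, w k * leftValue (averagedV V) Ψ (a k) x (y k) π - i) +
          lam * (ε * c + δ) / (1 - ε) := by
  have := S.nonempty x
  have hε := S.eps_pos
  have hε1 : 0 < 1 - ε := sub_pos.2 S.eps_lt
  have hgrad := hasGradientAt_add
    (hasGradientAt_const_mul (1 - ε) (hasGradientAt_sum s fun k _ => hasGradientAt_const_mul (w k)
      (hasGradientAt_const_mul (a k) (S.pen.hasGradientAt_left x (y k)))))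
    (hasGradientAt_const_mul ε (S.containment.isC1.hasGradientAt x))
  have htouch := S.sub.le_of_touching S.eig S.regV.continuous S.contA S.cont_h₁ S.lam_pos
    (S.exists_compact_nhds x) hgrad (fun x' => by
      have h := mul_le_mul_of_nonneg_left (hmax x') hε1.le
      simp only [perturbedSub, mul_sub, mul_div_cancel₀ _ hε1.ne'] at h
      linarith)
  set G : ℕ → EuclideanSpace ℝ (Fin d) := fun k =>
    a k • gradient (fun w => Ψ w (y k)) (x : EuclideanSpace ℝ (Fin d)) with hG
  obtain ⟨π, i, hi0, hi, hle⟩ := S.eig.exists_lt_averagedV_sub S.regI.nonneg x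
    ((1 - ε) • ∑ k ∈ s, w k • G k + ε • gradient Υ (x : EuclideanSpace ℝ (Fin d))) hδ
  refine ⟨π, i, hi0, hi, ?_⟩
  have hconvx := convexOn_averagedV (S.regV.convex x) π
  have hconv := hconvx.2 (Set.mem_univ (∑ k ∈ s, w k • G k))
    (Set.mem_univ (gradient Υ (x : EuclideanSpace ℝ (Fin d)))) hε1.le hε.le (by ring)
  have hsum := hconvx.map_sum_le hw0 hw1 (fun k _ => Set.mem_univ (G k))
  have hΥ := averagedV_le (S.V_le x) π
  simp only [smul_eq_mul] at hconv hsum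
  change averagedV V x _ π ≤ ∑ k ∈ s, w k * leftValue (averagedV V) Ψ (a k) x (y k) π at hsum
  set Lw := ∑ k ∈ s, w k * leftValue (averagedV V) Ψ (a k) x (y k) π
  have h1 : (effectiveHamiltonian V A x ((1 - ε) • ∑ k ∈ s, w k • G k +
      ε • gradient Υ (x : EuclideanSpace ℝ (Fin d)))).toReal ≤
      (1 - ε) * (Lw - i) + (ε * c + δ) := by
    have h2 := mul_le_mul_of_nonneg_left hsum hε1.le
    have h3 := mul_le_mul_of_nonneg_left hΥ hε.le
    have h4 : 0 ≤ ε * i := mul_nonneg hε.le hi0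
    linarith
  have h5 := htouch.trans (mul_le_mul_of_nonneg_left h1 S.lam_pos.le)
  rw [div_le_iff₀ hε1, add_mul, div_mul_cancel₀ _ hε1.ne']
  linarith

/-- The right values are bounded, uniformly in the slope `s` and in the measure: the supersolution
inequality with a measure of zero cost bounds the average of `V`, hence `V` at one point `z`, and
the growth condition extends the bound to all `z`. -/
theorem exists_rightValue_le (S : DoublingSetting E D V A Ψ Υ lam h₁ h₂ u v B c ε) {K : Set E}
    (hK : IsCompact K) : ∃ r : ℝ, ∀ (x : E) (s : ℝ), ∀ y ∈ K,
      (∀ y' : E, perturbedSuper Υ ε v y + s * Ψ x y ≤ perturbedSuper Υ ε v y' + s * Ψ x y') →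
      ∀ π, rightValue (averagedV V) Ψ s x y π ≤ r := by
  obtain ⟨M, C₁, C₂, hM, hC₁, hC₂, hgrowth⟩ := S.regV.growth K hK
  refine ⟨max M (C₁ * (2 * B / lam + ε * c) + C₂), fun x s y hy hmin π => ?_⟩
  obtain ⟨π₀, hπ₀⟩ := S.regI.exists_zero y
  have h1 := S.super_ineq hmin (i := 0) hπ₀
  have hε1 : 0 < 1 + ε := by linarith [S.eps_pos]
  have h2 : (v y - h₂ y) / (1 + ε) ≤ 2 * B := by
    rw [div_le_iff₀ hε1]
    have := mul_nonneg S.eps_pos.le (S.bound_nonneg y)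
    linarith [(abs_le.1 (S.v_le y)).2, (abs_le.1 (S.h₂_le y)).1]
  have h3 : rightValue (averagedV V) Ψ s x y π₀ ≤ 2 * B / lam + ε * c := by
    rw [← sub_le_iff_le_add, le_div_iff₀ S.lam_pos]
    linarith
  obtain ⟨z₀, hz₀⟩ := exists_le_of_averagedV_le h3
  refine averagedV_le (fun z => (hgrowth y hy _ z z₀).trans ?_) π
  exact max_le_max le_rfl (by gcongr)

/-- Pointwise vanishing of the doubling error: for fixed `x` and `π` with `I x π < ∞`, and
minimizers `y k` of the perturbed supersolution with penalty `α k * Ψ x`, the error is below every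
`δ > 0` for some `k`. The term with factor `N` is at most `N` times the drop of the perturbed
supersolution from `x` to `y k`, which tends to zero by lower semicontinuity. -/
theorem exists_error_lt (S : DoublingSetting E D V A Ψ Υ lam h₁ h₂ u v B c ε) {K : Set E}
    (hK : IsCompact K) {D₀ : ℝ} (hD₀ : ∀ x, perturbedSub Υ ε u x - perturbedSuper Υ ε v x ≤ D₀)
    {N : ℝ} (hN : 0 ≤ N) {x : E} (hxK : x ∈ K) {π : ProbabilityMeasure F} {i : ℝ}
    (hi : donskerVaradhan (A x) π = i) {α : ℕ → ℝ} (hα0 : ∀ k, 0 < α k)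
    (hα : Tendsto α atTop atTop) {y : ℕ → E} (hy : ∀ k, y k ∈ K)
    (hmin : ∀ k, ∀ y' : E, perturbedSuper Υ ε v (y k) + α k * Ψ x (y k) ≤
      perturbedSuper Υ ε v y' + α k * Ψ x y') {δ : ℝ} (hδ : 0 < δ) :
    ∃ k, lam * (leftValue (averagedV V) Ψ (α k) x (y k) π - i) - (v (y k) - h₂ x) / (1 + ε) -
      lam * (ε * c) + N * (perturbedSub Υ ε u x - perturbedSuper Υ ε v (y k) -
        α k * Ψ x (y k) - D₀) < δ := by
  by_contra! hcon
  have hε1 : 0 < 1 + ε := by linarith [S.eps_pos]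
  have hlam := S.lam_pos
  set W := perturbedSuper Υ ε v with hW
  have hpen0 : ∀ k, 0 ≤ α k * Ψ x (y k) := fun k =>
    mul_nonneg (hα0 k).le (S.pen.nonneg _ x.2 _ (y k).2)
  have hcmp : ∀ k, W (y k) + α k * Ψ x (y k) ≤ W x := fun k => by
    have := hmin k x
    rwa [S.pen.self_eq_zero, mul_zero, add_zero] at this
  have hWB : ∀ y, -B ≤ W y := S.neg_le_perturbedSuper
  -- the points converge to `x`, by the penalization
  have hΨ : Tendsto (fun k => Ψ x (y k)) atTop (𝓝 0) := by
    refine squeeze_zero (fun k => S.pen.nonneg _ x.2 _ (y k).2) (fun k => ?_)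
      ((tendsto_const_nhds (x := W x + B)).div_atTop hα)
    rw [le_div_iff₀ (hα0 k)]
    linarith [hcmp k, hWB (y k)]
  have hyx : Tendsto y atTop (𝓝 x) := S.pen.tendsto_of_tendsto_zero hK hy hΨ
  have hWev : ∀ τ > 0, ∀ᶠ k in atTop, W x - τ < W (y k) := fun τ hτ =>
    hyx.eventually (S.lowerSemicontinuous_perturbedSuper x _ (sub_lt_self _ hτ))
  have hpen : Tendsto (fun k => α k * Ψ x (y k)) atTop (𝓝 0) := by
    refine Metric.tendsto_nhds.2 fun τ hτ => (hWev τ hτ).mono fun k hk => ?_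
    rw [Real.dist_0_eq_abs, abs_of_nonneg (hpen0 k)]
    linarith [hcmp k]
  have hNle : ∀ k, N * (perturbedSub Υ ε u x - W (y k) - α k * Ψ x (y k) - D₀) ≤
      N * (W x - W (y k)) := fun k =>
    mul_le_mul_of_nonneg_left (by linarith [hD₀ x, hpen0 k]) hN
  obtain ⟨r, hr⟩ := S.exists_rightValue_le hK
  -- lower bound for the left values
  have hL : ∀ k, (δ + -(2 * B) - N * (W x + B)) / lam + i ≤
      leftValue (averagedV V) Ψ (α k) x (y k) π := by
    intro k
    rw [← le_sub_iff_add_le, div_le_iff₀ hlam]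
    have h1 := hcon k
    have h2 := (hNle k).trans (mul_le_mul_of_nonneg_left
      (show W x - W (y k) ≤ W x + B by linarith [hWB (y k)]) hN)
    have h3 : -(2 * B) ≤ (v (y k) - h₂ x) / (1 + ε) := by
      rw [le_div_iff₀ hε1]
      have := mul_nonneg S.eps_pos.le (S.bound_nonneg x)
      linarith [(abs_le.1 (S.v_le (y k))).1, (abs_le.1 (S.h₂_le x)).2]
    have h4 : 0 ≤ lam * (ε * c) := mul_nonneg hlam.le (mul_nonneg S.eps_pos.le S.c_nonneg)
    linarith
  obtain ⟨τ, hτ, hτδ⟩ : ∃ τ > 0, (2 * lam + 1 + N) * τ < δ := by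
    refine ⟨δ / (2 * (2 * lam + 1 + N)), by positivity, ?_⟩
    have : (2 * lam + 1 + N) * (δ / (2 * (2 * lam + 1 + N))) = δ / 2 := by field_simp
    linarith
  have hfreq := S.estimate.frequently_sub_lt S.pen (π := fun _ => π) hK isCompact_singleton hα0 hα
    (fun _ => hxK) hy (fun _ => Set.mem_singleton π) hpen (fun k => hr x (α k) (y k) (hy k)
      (hmin k) π) hL hτ
  have hh := (S.cont_h₂.tendsto x).comp hyx
  obtain ⟨k, hk1, hk2, hk3, j, hj, hji⟩ := (hfreq.and_eventually ((hWev τ hτ).and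
    ((Metric.tendsto_nhds.1 hh τ hτ).and (S.regI.eventually_abs_toReal_sub_le hi hyx hτ)))).exists
  have h1 := S.super_ineq (hmin k) hj
  have h2 := hcon k
  have h3 := (hNle k).trans (mul_le_mul_of_nonneg_left
    (show W x - W (y k) ≤ τ by linarith) hN)
  have h4 : (v (y k) - h₂ x) / (1 + ε) = (v (y k) - h₂ (y k)) / (1 + ε) -
      (h₂ x - h₂ (y k)) / (1 + ε) := by ring
  have h5 : (h₂ x - h₂ (y k)) / (1 + ε) ≤ τ := by
    rw [div_le_iff₀ hε1]
    rw [Real.dist_eq] at hk3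
    have := mul_nonneg S.eps_pos.le hτ.le
    have h6 := (abs_lt.1 hk3).1
    simp only [Function.comp_apply] at h6
    linarith
  have h6 : lam * (leftValue (averagedV V) Ψ (α k) x (y k) π -
      rightValue (averagedV V) Ψ (α k) x (y k) π + (j - i)) ≤ lam * (τ + τ) :=
    mul_le_mul_of_nonneg_left (by linarith [(abs_le.1 hji).2]) hlam.le
  linarith

end DoublingSetting

/-! ### Doubling with one left and many right variables -/

theorem exists_forall_add_le {X : Type*} [TopologicalSpace X] {W : X → ℝ}
    (hW : LowerSemicontinuous W) {K : Set X} (hK : IsCompact K) {P : X × Bool → ℝ}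
    (hP : Continuous P) (hP0 : ∀ c, 0 ≤ P c) {x : X} (hP1 : P (x, true) = 0)
    (hWK : ∀ y, W y ≤ W x → y ∈ K) :
    ∃ c : X × Bool, ∀ c' : X × Bool, W c.1 + P c ≤ W c'.1 + P c' := by
  have hlsc : LowerSemicontinuous fun c : X × Bool => W c.1 + P c :=
    (hW.comp continuous_fst).add hP.lowerSemicontinuous
  have hxK : (x, true) ∈ K ×ˢ (Set.univ : Set Bool) := ⟨hWK x le_rfl, Set.mem_univ _⟩
  obtain ⟨c, -, hc⟩ := (hlsc.lowerSemicontinuousOn _).exists_isMinOn ⟨_, hxK⟩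
    (hK.prod (Set.finite_univ (α := Bool)).isCompact)
  refine ⟨c, fun c' => ?_⟩
  by_cases hc' : c'.1 ∈ K
  · exact hc (show c' ∈ K ×ˢ (Set.univ : Set Bool) from ⟨hc', Set.mem_univ _⟩)
  · have h1 : W c.1 + P c ≤ W x + P (x, true) := hc hxK
    have h2 : W x < W c'.1 := lt_of_not_ge fun h => hc' (hWK _ h)
    linarith [hP0 c']

/-- Doubling with one left and many right variables, for a penalty with two branches, of which the
branch `true` vanishes on the diagonal: there are a maximum point `x` and right variables `c k`,
each of which minimizes its own term given `x`. Indices outside `s` have no influence on the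
functional, and the choice of `c k` as a minimizer is made for these as well. -/
theorem exists_max_sub_sum_min {X : Type*} [TopologicalSpace X] {U W : X → ℝ}
    (hU : UpperSemicontinuous U) (hW : LowerSemicontinuous W) {K K' : Set X} (hK : IsCompact K)
    (hK' : IsCompact K') {P : ℕ → X → X × Bool → ℝ}
    (hP : ∀ k, Continuous fun q : X × (X × Bool) => P k q.1 q.2) (hP0 : ∀ k x c, 0 ≤ P k x c)
    (hP1 : ∀ k x, P k x (x, true) = 0) {x₀ : X} {s : Finset ℕ} {w : ℕ → ℝ}
    (hw0 : ∀ k ∈ s, 0 ≤ w k) (hw1 : ∑ k ∈ s, w k = 1)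
    (hUK : ∀ (x : X) (y : ℕ → X), U x₀ - W x₀ ≤ U x - ∑ k ∈ s, w k * W (y k) → x ∈ K)
    (hWK : ∀ x ∈ K, ∀ y, W y ≤ W x → y ∈ K') :
    ∃ x ∈ K, ∃ c : ℕ → X × Bool,
      (∀ k c', W (c k).1 + P k x (c k) ≤ W c'.1 + P k x c') ∧
      (∀ x', U x' - ∑ k ∈ s, w k * (W (c k).1 + P k x' (c k)) ≤
        U x - ∑ k ∈ s, w k * (W (c k).1 + P k x (c k))) ∧
      U x₀ - W x₀ ≤ U x - ∑ k ∈ s, w k * (W (c k).1 + P k x (c k)) := by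
  set Φ : X × (ℕ → X × Bool) → ℝ := fun q =>
    U q.1 - ∑ k ∈ s, w k * (W (q.2 k).1 + P k q.1 (q.2 k)) with hΦ
  have hΦusc : UpperSemicontinuous Φ := by
    have h1 : ∀ k ∈ s, UpperSemicontinuous fun q : X × (ℕ → X × Bool) =>
        -w k * (W (q.2 k).1 + P k q.1 (q.2 k)) := by
      intro k hk
      have h2 : LowerSemicontinuous fun q : X × (ℕ → X × Bool) =>
          W (q.2 k).1 + P k q.1 (q.2 k) :=
        (hW.comp (by fun_prop)).add
          ((hP k).comp (by fun_prop : Continuous fun q : X × (ℕ → X × Bool) =>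
            (q.1, q.2 k))).lowerSemicontinuous
      exact (continuous_const_mul (-w k)).comp_lowerSemicontinuous_antitone h2
        fun a b hab => mul_le_mul_of_nonpos_left hab (neg_nonpos.2 (hw0 k hk))
    have h3 := (hU.comp (continuous_fst (X := X) (Y := ℕ → X × Bool))).add
      (upperSemicontinuous_sum h1)
    have h4 : Φ = fun q : X × (ℕ → X × Bool) => (U ∘ Prod.fst) q +
        ∑ k ∈ s, -w k * (W (q.2 k).1 + P k q.1 (q.2 k)) := by
      funext q
      simp only [hΦ, neg_mul, Finset.sum_neg_distrib, Function.comp_apply, sub_eq_add_neg]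
    rw [h4]
    exact h3
  have hx₀Φ : Φ (x₀, fun _ => (x₀, true)) = U x₀ - W x₀ := by
    simp only [hΦ, hP1, add_zero, ← Finset.sum_mul, hw1, one_mul]
  have hmemK : ∀ x (c : ℕ → X × Bool), U x₀ - W x₀ ≤ Φ (x, c) → x ∈ K := by
    intro x c h
    refine hUK x (fun k => (c k).1) (h.trans (sub_le_sub_left (Finset.sum_le_sum fun k hk => ?_) _))
    exact mul_le_mul_of_nonneg_left (le_add_of_nonneg_right (hP0 _ _ _)) (hw0 k hk)
  have hx₀K : x₀ ∈ K := hmemK x₀ _ hx₀Φ.ge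
  have hcomp : IsCompact (K ×ˢ Set.univ.pi fun _ : ℕ => K' ×ˢ (Set.univ : Set Bool)) :=
    hK.prod (isCompact_univ_pi fun _ => hK'.prod (Set.finite_univ (α := Bool)).isCompact)
  have hx₀mem : (x₀, fun _ => (x₀, true)) ∈
      K ×ˢ Set.univ.pi fun _ : ℕ => K' ×ˢ (Set.univ : Set Bool) :=
    ⟨hx₀K, fun _ _ => ⟨hWK x₀ hx₀K x₀ le_rfl, Set.mem_univ _⟩⟩
  obtain ⟨⟨x, c₁⟩, ⟨hxK, -⟩, hmax⟩ := (hΦusc.upperSemicontinuousOn _).exists_isMaxOn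
    ⟨_, hx₀mem⟩ hcomp
  -- The coordinates outside `s` of a maximizer are arbitrary: replace all of them by minimizers.
  choose c hc using fun k => exists_forall_add_le hW hK'
    ((hP k).comp (continuous_const.prodMk continuous_id)) (hP0 k x) (hP1 k x) (hWK x hxK)
  have hcK' : ∀ k, (c k).1 ∈ K' := fun k => by
    have h1 : W (c k).1 + P k x (c k) ≤ W x + P k x (x, true) := hc k (x, true)
    rw [hP1, add_zero] at h1
    exact hWK x hxK _ (by linarith [hP0 k x (c k)])
  have hle : Φ (x, c₁) ≤ Φ (x, c) := sub_le_sub_left (Finset.sum_le_sum fun k hk =>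
    mul_le_mul_of_nonneg_left (hc k (c₁ k)) (hw0 k hk)) _
  have hx₀le : U x₀ - W x₀ ≤ Φ (x, c₁) := by
    rw [← hx₀Φ]
    exact hmax hx₀mem
  refine ⟨x, hxK, c, hc, fun x' => ?_, hx₀le.trans hle⟩
  by_cases hx' : x' ∈ K
  · exact le_trans (hmax (show (x', c) ∈ K ×ˢ Set.univ.pi fun _ : ℕ => K' ×ˢ (Set.univ : Set Bool)
      from ⟨hx', fun k _ => ⟨hcK' k, Set.mem_univ _⟩⟩)) hle
  · have h1 : Φ (x', c) < U x₀ - W x₀ := lt_of_not_ge fun h => hx' (hmemK x' c h)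
    exact (h1.le.trans hx₀le).trans hle

/-- The slope of a branch of the capped penalty: `α` on the branch `true`, `α₀` on `false`. -/
def branchSlope (α₀ α : ℝ) (b : Bool) : ℝ := if b then α else α₀

/-- The minimum of `α * Ψ` and `α₀ * Ψ + η`, with the choice of the branch as an additional
variable. In this form each branch is differentiable, while minimizing over the variable `(y, b) :
E × Bool` amounts to using the minimum. -/
def cappedPenalty {d : ℕ} {E : Set (EuclideanSpace ℝ (Fin d))}
    (Ψ : EuclideanSpace ℝ (Fin d) → EuclideanSpace ℝ (Fin d) → ℝ) (α₀ η α : ℝ) (x : E)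
    (c : E × Bool) : ℝ :=
  branchSlope α₀ α c.2 * Ψ x c.1 + if c.2 then 0 else η

theorem continuous_cappedPenalty {d : ℕ} {E : Set (EuclideanSpace ℝ (Fin d))}
    {Ψ : EuclideanSpace ℝ (Fin d) → EuclideanSpace ℝ (Fin d) → ℝ} (hΨ : IsPenalization E Ψ)
    (α₀ η α : ℝ) : Continuous fun q : E × (E × Bool) => cappedPenalty Ψ α₀ η α q.1 q.2 := by
  have h1 : Continuous (branchSlope α₀ α) := continuous_of_discreteTopology
  have h2 : Continuous fun b : Bool => if b then (0 : ℝ) else η := continuous_of_discreteTopology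
  have h3 : Continuous fun q : E × (E × Bool) => Ψ q.1 q.2.1 :=
    hΨ.continuous.comp (by fun_prop : Continuous fun q : E × (E × Bool) => (q.1, q.2.1))
  exact ((h1.comp (by fun_prop)).mul h3).add (h2.comp (by fun_prop))

theorem lowerSemicontinuous_toReal_min {X : Type*} [TopologicalSpace X] {I : X → EReal}
    (hI : LowerSemicontinuous I) (h0 : ∀ x, 0 ≤ I x) {M : ℝ} (hM : 0 ≤ M) :
    LowerSemicontinuous fun x => (min (I x) M).toReal := by
  have hcoe : ∀ x, (((min (I x) M).toReal : ℝ) : EReal) = min (I x) M := fun x =>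
    EReal.coe_toReal ((min_le_right _ _).trans_lt (EReal.coe_lt_top _)).ne
      (EReal.bot_lt_zero.trans_le (le_min (h0 x) (EReal.coe_nonneg.2 hM))).ne'
  have hmin : LowerSemicontinuous fun x => min (I x) (M : EReal) :=
    hI.inf lowerSemicontinuous_const
  intro x t ht
  have h1 : (t : EReal) < min (I x) M := by rw [← hcoe]; exact EReal.coe_lt_coe_iff.2 ht
  refine (hmin x t h1).mono fun y hy => ?_
  have h2 : (t : EReal) < min (I y) M := hy
  rw [← hcoe] at h2
  exact EReal.coe_lt_coe_iff.1 h2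

namespace DoublingSetting

variable {d : ℕ} {E : Set (EuclideanSpace ℝ (Fin d))}
  {F : Type*} [TopologicalSpace F] [CompactSpace F] [MeasurableSpace F] [OpensMeasurableSpace F]
  {D : Submodule ℝ C(F, ℝ)} {V : E → EuclideanSpace ℝ (Fin d) → C(F, ℝ)}
  {A : E → D →ₗ[ℝ] C(F, ℝ)} {Ψ : EuclideanSpace ℝ (Fin d) → EuclideanSpace ℝ (Fin d) → ℝ}
  {Υ : EuclideanSpace ℝ (Fin d) → ℝ} {lam : ℝ} {h₁ h₂ u v : E → ℝ} {B c ε : ℝ}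

/-- For a large fixed slope, the doubled functional hardly exceeds its supremum on the diagonal. -/
theorem exists_sub_penalty_le (S : DoublingSetting E D V A Ψ Υ lam h₁ h₂ u v B c ε) {K : Set E}
    (hK : IsCompact K) {D₀ : ℝ} (hD₀ : ∀ x, perturbedSub Υ ε u x - perturbedSuper Υ ε v x ≤ D₀)
    {η : ℝ} (hη : 0 < η) : ∃ α > 0, ∀ x ∈ K, ∀ y ∈ K,
      perturbedSub Υ ε u x - perturbedSuper Υ ε v y - α * Ψ x y ≤ D₀ + η := by
  by_contra! hcon
  have hpos : ∀ n : ℕ, (0 : ℝ) < (n : ℝ) + 1 := fun n => by positivity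
  choose x hx y hy hxy using fun n : ℕ => hcon _ (hpos n)
  have hε1 : 0 < 1 - ε := sub_pos.2 S.eps_lt
  have hU : ∀ x, perturbedSub Υ ε u x ≤ B / (1 - ε) := fun x => by
    rw [perturbedSub]
    have := mul_nonneg S.eps_pos.le (S.containment.nonneg x x.2)
    exact div_le_div_of_nonneg_right (by linarith [(abs_le.1 (S.u_le x)).2]) hε1.le
  have hΨ : Tendsto (fun n => Ψ (x n) (y n)) atTop (𝓝 0) := by
    refine squeeze_zero (g := fun n : ℕ => (B / (1 - ε) + B - D₀ - η) / ((n : ℝ) + 1))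
      (fun k => S.pen.nonneg _ (x k).2 _ (y k).2) (fun k => ?_)
      (tendsto_const_nhds.div_atTop
        (tendsto_atTop_add_const_right _ _ tendsto_natCast_atTop_atTop))
    rw [le_div_iff₀ (hpos k)]
    linarith [hxy k, hU (x k), S.neg_le_perturbedSuper (y k)]
  obtain ⟨⟨x', y'⟩, -, φ, hφ, hlim⟩ := (hK.prod hK).tendsto_subseq
    (x := fun n => (x n, y n)) (fun n => ⟨hx n, hy n⟩)
  have hΨlim : Ψ x' y' = 0 := tendsto_nhds_unique
    ((S.pen.continuous.tendsto (x', y')).comp hlim) (hΨ.comp hφ.tendsto_atTop)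
  obtain rfl : x' = y' := Subtype.ext ((S.pen.eq_zero_iff x' x'.2 y' y'.2).1 hΨlim)
  have h1 := (continuous_fst.tendsto (x', x')).comp hlim
  have h2 := (continuous_snd.tendsto (x', x')).comp hlim
  obtain ⟨n, hn1, hn2⟩ := ((h1.eventually (S.upperSemicontinuous_perturbedSub x' _
    (lt_add_of_pos_right _ (half_pos hη)))).and (h2.eventually
    (S.lowerSemicontinuous_perturbedSuper x' _ (sub_lt_self _ (half_pos hη))))).exists
  simp only [Function.comp_apply] at hn1 hn2
  have h3 := mul_nonneg (hpos (φ n)).le (S.pen.nonneg _ (x (φ n)).2 _ (y (φ n)).2)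
  linarith [hxy (φ n), hD₀ x']

/-- Points at which the perturbed subsolution is not too small lie in a sublevel set of `Υ`. -/
theorem sublevel_of_le (S : DoublingSetting E D V A Ψ Υ lam h₁ h₂ u v B c ε) (t : ℝ) (x : E)
    (hx : t ≤ perturbedSub Υ ε u x + B) : Υ x ≤ (B + (1 - ε) * (B - t)) / ε := by
  rw [le_div_iff₀ S.eps_pos]
  have h1 : (t - B) * (1 - ε) ≤ u x - ε * Υ x := by
    rw [← le_div_iff₀ (sub_pos.2 S.eps_lt)]
    exact sub_le_iff_le_add.2 hx
  linarith [(abs_le.1 (S.u_le x)).2]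

/-- The difference of the perturbed sub- and supersolution attains its maximum. -/
theorem exists_max (S : DoublingSetting E D V A Ψ Υ lam h₁ h₂ u v B c ε) [Nonempty E] :
    ∃ x₀, ∀ x, perturbedSub Υ ε u x - perturbedSuper Υ ε v x ≤
      perturbedSub Υ ε u x₀ - perturbedSuper Υ ε v x₀ := by
  obtain ⟨x₁⟩ := ‹Nonempty E›
  set D₁ : ℝ := perturbedSub Υ ε u x₁ - perturbedSuper Υ ε v x₁ with hD₁
  have husc : UpperSemicontinuous fun x => perturbedSub Υ ε u x + -1 * perturbedSuper Υ ε v x :=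
    S.upperSemicontinuous_perturbedSub.add
      ((continuous_const_mul (-1 : ℝ)).comp_lowerSemicontinuous_antitone
        S.lowerSemicontinuous_perturbedSuper fun a b hab => by simpa using hab)
  have hmem := S.sublevel_of_le D₁
  have hx₁ := hmem x₁ (by linarith [S.neg_le_perturbedSuper x₁])
  obtain ⟨x₀, -, hx₀⟩ := (husc.upperSemicontinuousOn _).exists_isMaxOn ⟨x₁, hx₁⟩
    (S.containment.compact_sublevel ((B + (1 - ε) * (B - D₁)) / ε))
  have hle : ∀ x : E, Υ x ≤ (B + (1 - ε) * (B - D₁)) / ε →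
      perturbedSub Υ ε u x + -1 * perturbedSuper Υ ε v x ≤
        perturbedSub Υ ε u x₀ + -1 * perturbedSuper Υ ε v x₀ := fun x hx => hx₀ hx
  refine ⟨x₀, fun x => ?_⟩
  by_cases hx : Υ x ≤ (B + (1 - ε) * (B - D₁)) / ε
  · linarith [hle x hx]
  · have h1 : perturbedSub Υ ε u x + B < D₁ := lt_of_not_ge fun h => hx (hmem x h)
    linarith [S.neg_le_perturbedSuper x, hle x₁ hx₁]

end DoublingSetting

/-! ### Comparison for the perturbed functions -/

namespace DoublingSetting

variable {d : ℕ} {E : Set (EuclideanSpace ℝ (Fin d))}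
  {F : Type*} [MetricSpace F] [CompactSpace F] [MeasurableSpace F] [BorelSpace F]
  {D : Submodule ℝ C(F, ℝ)} {V : E → EuclideanSpace ℝ (Fin d) → C(F, ℝ)}
  {A : E → D →ₗ[ℝ] C(F, ℝ)} {Ψ : EuclideanSpace ℝ (Fin d) → EuclideanSpace ℝ (Fin d) → ℝ}
  {Υ : EuclideanSpace ℝ (Fin d) → ℝ} {lam : ℝ} {h₁ h₂ u v : E → ℝ} {B c ε : ℝ}

theorem continuous_leftValue (S : DoublingSetting E D V A Ψ Υ lam h₁ h₂ u v B c ε) :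
    Continuous fun q : ℝ × (E × E) × ProbabilityMeasure F =>
      leftValue (averagedV V) Ψ q.1 q.2.1.1 q.2.1.2 q.2.2 := by
  have h1 : Continuous fun q : ℝ × (E × E) × ProbabilityMeasure F =>
      q.1 • gradient (fun w => Ψ w q.2.1.2) (q.2.1.1 : EuclideanSpace ℝ (Fin d)) :=
    continuous_fst.smul (S.pen.continuous_gradient_left.comp
      (by fun_prop : Continuous fun q : ℝ × (E × E) × ProbabilityMeasure F => q.2.1))
  exact (continuous_averagedV S.regV.continuous).comp
    (((by fun_prop : Continuous fun q : ℝ × (E × E) × ProbabilityMeasure F => q.2.1.1).prodMk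
      h1).prodMk (by fun_prop))

/-- The doubling error at the left point `x` with the measure `π` and the right variable `b`, plus
`N` times the excess of the doubled functional over `D₀`. The cost is truncated at `M`, so that the
error is real-valued and upper semicontinuous everywhere. -/
noncomputable def errorTerm (V : E → EuclideanSpace ℝ (Fin d) → C(F, ℝ))
    (A : E → D →ₗ[ℝ] C(F, ℝ)) (Ψ : EuclideanSpace ℝ (Fin d) → EuclideanSpace ℝ (Fin d) → ℝ)
    (Υ : EuclideanSpace ℝ (Fin d) → ℝ) (lam : ℝ) (h₂ u v : E → ℝ) (c ε α₀ η M N D₀ α : ℝ)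
    (x : E) (π : ProbabilityMeasure F) (b : E × Bool) : ℝ :=
  lam * (leftValue (averagedV V) Ψ (branchSlope α₀ α b.2) x b.1 π -
      (min (donskerVaradhan (A x) π) M).toReal) -
    (v b.1 - h₂ x) / (1 + ε) - lam * (ε * c) +
    N * (perturbedSub Υ ε u x - perturbedSuper Υ ε v b.1 - cappedPenalty Ψ α₀ η α x b - D₀)

theorem upperSemicontinuous_errorTerm (S : DoublingSetting E D V A Ψ Υ lam h₁ h₂ u v B c ε)
    {α₀ η M N D₀ α : ℝ} (hM : 0 ≤ M) (hN : 0 ≤ N) :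
    UpperSemicontinuous fun q : (E × ProbabilityMeasure F) × (E × Bool) =>
      errorTerm V A Ψ Υ lam h₂ u v c ε α₀ η M N D₀ α q.1.1 q.1.2 q.2 := by
  have hε1 : 0 < 1 + ε := by linarith [S.eps_pos]
  have hslope : Continuous (branchSlope α₀ α) := continuous_of_discreteTopology
  have h1 : Continuous fun q : (E × ProbabilityMeasure F) × (E × Bool) =>
      lam * leftValue (averagedV V) Ψ (branchSlope α₀ α q.2.2) q.1.1 q.2.1 q.1.2 +
        h₂ q.1.1 / (1 + ε) - lam * (ε * c) -
        N * (cappedPenalty Ψ α₀ η α q.1.1 q.2 + D₀) := by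
    have h2 := S.continuous_leftValue.comp (((hslope.comp (by fun_prop)).prodMk
      (by fun_prop : Continuous fun q : (E × ProbabilityMeasure F) × (E × Bool) =>
        ((q.1.1, q.2.1), q.1.2))) : Continuous fun q : (E × ProbabilityMeasure F) × (E × Bool) =>
        (branchSlope α₀ α q.2.2, ((q.1.1, q.2.1), q.1.2)))
    have h3 := (continuous_cappedPenalty S.pen α₀ η α).comp
      (by fun_prop : Continuous fun q : (E × ProbabilityMeasure F) × (E × Bool) => (q.1.1, q.2))
    have h4 := S.cont_h₂.comp
      (by fun_prop : Continuous fun q : (E × ProbabilityMeasure F) × (E × Bool) => q.1.1)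
    exact (((h2.const_mul lam).add (h4.div_const _)).sub continuous_const).sub
      ((h3.add continuous_const).const_mul N)
  have h2 : UpperSemicontinuous fun q : (E × ProbabilityMeasure F) × (E × Bool) =>
      -lam * (min (donskerVaradhan (A q.1.1) q.1.2) M).toReal :=
    (continuous_const_mul (-lam)).comp_lowerSemicontinuous_antitone
      ((lowerSemicontinuous_toReal_min S.regI.lsc (fun q => S.regI.nonneg q.1 q.2) hM).comp
        continuous_fst) fun a b hab => mul_le_mul_of_nonpos_left hab (neg_nonpos.2 S.lam_pos.le)
  have h3 : UpperSemicontinuous fun q : (E × ProbabilityMeasure F) × (E × Bool) =>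
      -(1 / (1 + ε)) * v q.2.1 :=
    (continuous_const_mul (-(1 / (1 + ε)))).comp_lowerSemicontinuous_antitone
      (LowerSemicontinuous.comp (f := v) S.super.2.1 (by fun_prop))
      fun a b hab => mul_le_mul_of_nonpos_left hab (neg_nonpos.2 (by positivity))
  have h4 : UpperSemicontinuous fun q : (E × ProbabilityMeasure F) × (E × Bool) =>
      N * perturbedSub Υ ε u q.1.1 :=
    (continuous_const_mul N).comp_upperSemicontinuous
      (S.upperSemicontinuous_perturbedSub.comp (by fun_prop))
      fun a b hab => mul_le_mul_of_nonneg_left hab hN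
  have h5 : UpperSemicontinuous fun q : (E × ProbabilityMeasure F) × (E × Bool) =>
      -N * perturbedSuper Υ ε v q.2.1 :=
    (continuous_const_mul (-N)).comp_lowerSemicontinuous_antitone
      (S.lowerSemicontinuous_perturbedSuper.comp (by fun_prop))
      fun a b hab => mul_le_mul_of_nonpos_left hab (neg_nonpos.2 hN)
  have h6 := (((h1.upperSemicontinuous.add h2).add h3).add h4).add h5
  have h7 : (fun q : (E × ProbabilityMeasure F) × (E × Bool) =>
      errorTerm V A Ψ Υ lam h₂ u v c ε α₀ η M N D₀ α q.1.1 q.1.2 q.2) = fun q =>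
      lam * leftValue (averagedV V) Ψ (branchSlope α₀ α q.2.2) q.1.1 q.2.1 q.1.2 +
        h₂ q.1.1 / (1 + ε) - lam * (ε * c) - N * (cappedPenalty Ψ α₀ η α q.1.1 q.2 + D₀) +
      -lam * (min (donskerVaradhan (A q.1.1) q.1.2) M).toReal + -(1 / (1 + ε)) * v q.2.1 +
      N * perturbedSub Υ ε u q.1.1 + -N * perturbedSuper Υ ε v q.2.1 := by
    funext q
    simp only [errorTerm]
    ring
  rw [h7]
  exact h6

/-- The comparison principle for the perturbed functions, up to terms of order `ε`. -/
theorem perturbed_sub_le (S : DoublingSetting E D V A Ψ Υ lam h₁ h₂ u v B c ε) {s : ℝ}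
    (hs : ∀ x, h₁ x - h₂ x ≤ s) {x₀ : E}
    (hx₀ : ∀ x, perturbedSub Υ ε u x - perturbedSuper Υ ε v x ≤
      perturbedSub Υ ε u x₀ - perturbedSuper Υ ε v x₀) :
    perturbedSub Υ ε u x₀ - perturbedSuper Υ ε v x₀ ≤
      s + 2 * B * ε / (1 - ε) + 2 * lam * (ε * c) / (1 - ε) := by
  have hε := S.eps_pos
  have hε1 : 0 < 1 - ε := sub_pos.2 S.eps_lt
  have hε2 : 0 < 1 + ε := by linarith
  have hB := S.bound_nonneg x₀
  have hlam := S.lam_pos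
  have hc := S.c_nonneg
  have := S.nonempty x₀
  set U := perturbedSub Υ ε u with hU
  set W := perturbedSuper Υ ε v with hW
  set D₀ := U x₀ - W x₀ with hD₀
  have hWB : ∀ y, -B ≤ W y := S.neg_le_perturbedSuper
  -- compact sets that contain all points of the argument
  set c₁ : ℝ := (B + (1 - ε) * (B - D₀)) / ε with hc₁
  set K₁ : Set E := {x | Υ x ≤ c₁} with hK₁
  set K₂ : Set E := {x | Υ x ≤ c₁ + 2 * B / ε} with hK₂
  have hK₁c : IsCompact K₁ := S.containment.compact_sublevel _
  have hK₂c : IsCompact K₂ := S.containment.compact_sublevel _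
  have hK₁₂ : K₁ ⊆ K₂ := fun x hx => le_trans (show Υ x ≤ c₁ from hx)
    (le_add_of_nonneg_right (by positivity))
  have hUK : ∀ x, D₀ ≤ U x + B → x ∈ K₁ := S.sublevel_of_le D₀
  have hWK : ∀ x ∈ K₁, ∀ y, W y ≤ W x → y ∈ K₂ := by
    intro x hx y hy
    change Υ y ≤ c₁ + 2 * B / ε
    have h1 : v y + ε * Υ y ≤ v x + ε * Υ x := (div_le_div_iff_of_pos_right hε2).1 hy
    have h2 : Υ x ≤ c₁ := hx
    have h3 : ε * Υ y ≤ ε * (c₁ + 2 * B / ε) := by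
      have h4 : ε * (2 * B / ε) = 2 * B := mul_div_cancel₀ _ hε.ne'
      rw [mul_add, h4]
      have := mul_le_mul_of_nonneg_left h2 hε.le
      linarith [(abs_le.1 (S.v_le y)).1, (abs_le.1 (S.v_le x)).2]
    exact le_of_mul_le_mul_left h3 hε
  -- The constants. `CL` bounds the left values on both branches, `M` bounds the cost of the measure
  -- produced by the subsolution inequality, `Ce` bounds the error without the multiplier, and `N`
  -- is such that `N * (η / 2) = Ce`.
  obtain ⟨r, hr⟩ := S.exists_rightValue_le hK₂c
  obtain ⟨η', hη', a, ha, hest⟩ := S.estimate.exists_leftValue_le S.pen hK₂c r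
  set η : ℝ := η' / 2 with hη
  have hη0 : 0 < η := half_pos hη'
  obtain ⟨α₀, hα₀, hpenD⟩ := S.exists_sub_penalty_le hK₂c hx₀ (half_pos hη0)
  obtain ⟨C₀, hC₀⟩ : ∃ C₀ : ℝ, ∀ x ∈ K₂, ∀ y ∈ K₂, ∀ π,
      leftValue (averagedV V) Ψ α₀ x y π ≤ C₀ := by
    have h1 : IsCompact (({α₀} : Set ℝ) ×ˢ (K₂ ×ˢ K₂) ×ˢ (Set.univ : Set (ProbabilityMeasure F))) :=
      isCompact_singleton.prod ((hK₂c.prod hK₂c).prod isCompact_univ)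
    obtain ⟨C₀, hC₀⟩ := h1.bddAbove_image S.continuous_leftValue.continuousOn
    exact ⟨C₀, fun x hx y hy π => hC₀ ⟨(α₀, (x, y), π), ⟨rfl, ⟨hx, hy⟩, Set.mem_univ _⟩, rfl⟩⟩
  set CL : ℝ := max 0 (max C₀ (r + 1)) with hCL
  have hCL0 : 0 ≤ CL := le_max_left _ _
  set M : ℝ := CL + 2 * B / (1 - ε) / lam + (ε * c + 1) / (1 - ε) with hM
  have hM0 : 0 ≤ M := by positivity
  set Ce : ℝ := lam * CL + 2 * B with hCe
  have hCe0 : 0 ≤ Ce := by positivity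
  set N : ℝ := 2 * Ce / η with hN
  have hN0 : 0 ≤ N := by positivity
  -- The bound `2 * α₀ ≤ α k` gives `α k * Ψ ≤ 2 * η` on the branch `true`, at minimizers.
  set α : ℕ → ℝ := fun k => a + 2 * α₀ + k with hα
  have hαa : ∀ k, a ≤ α k := fun k => by
    have : (0 : ℝ) ≤ k := k.cast_nonneg
    simp only [hα]; linarith
  have hα2 : ∀ k, 2 * α₀ ≤ α k := fun k => by
    have : (0 : ℝ) ≤ k := k.cast_nonneg
    simp only [hα]; linarith
  have hαpos : ∀ k, 0 < α k := fun k => ha.trans_le (hαa k)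
  have hαtop : Tendsto α atTop atTop :=
    tendsto_atTop_add_const_left _ _ tendsto_natCast_atTop_atTop
  -- penalties
  set P : ℕ → E → E × Bool → ℝ := fun k => cappedPenalty Ψ α₀ η (α k) with hP
  have hΨ0 : ∀ x y : E, 0 ≤ Ψ x y := fun x y => S.pen.nonneg x x.2 y y.2
  have hPt : ∀ k x y, P k x (y, true) = α k * Ψ x y := fun k x y => by
    simp [hP, cappedPenalty, branchSlope]
  have hPf : ∀ k x y, P k x (y, false) = α₀ * Ψ x y + η := fun k x y => by
    simp [hP, cappedPenalty, branchSlope]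
  have hPα₀ : ∀ k (x : E) b, α₀ * Ψ x b.1 ≤ P k x b := by
    rintro k x ⟨y, _ | _⟩
    · rw [hPf]; linarith
    · rw [hPt]
      exact mul_le_mul_of_nonneg_right (by linarith [hα2 k]) (hΨ0 x y)
  have hP0 : ∀ k x b, 0 ≤ P k x b := fun k x b =>
    (mul_nonneg hα₀.le (hΨ0 x b.1)).trans (hPα₀ k x b)
  have hP1 : ∀ k x, P k x (x, true) = 0 := fun k x => by
    rw [hPt, S.pen.self_eq_zero, mul_zero]
  have hPc : ∀ k, Continuous fun q : E × (E × Bool) => P k q.1 q.2 := fun k =>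
    continuous_cappedPenalty S.pen _ _ _
  -- consequences of minimality
  have hminK : ∀ k, ∀ x ∈ K₁, ∀ b, (∀ b', W b.1 + P k x b ≤ W b'.1 + P k x b') → b.1 ∈ K₂ := by
    intro k x hx b hb
    have h1 := hb (x, true)
    rw [hP1, add_zero] at h1
    exact hWK x hx _ (by linarith [hP0 k x b])
  have hminS : ∀ k x b, (∀ b', W b.1 + P k x b ≤ W b'.1 + P k x b') → ∀ y' : E,
      W b.1 + branchSlope α₀ (α k) b.2 * Ψ x b.1 ≤
        W y' + branchSlope α₀ (α k) b.2 * Ψ x y' := by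
    rintro k x ⟨y, b⟩ hb y'
    have h1 := hb (y', b)
    simp only [hP, cappedPenalty] at h1 ⊢
    linarith
  have hLle : ∀ k, ∀ x ∈ K₁, ∀ b, (∀ b', W b.1 + P k x b ≤ W b'.1 + P k x b') → ∀ π,
      leftValue (averagedV V) Ψ (branchSlope α₀ (α k) b.2) x b.1 π ≤ CL := by
    rintro k x hx ⟨y, _ | _⟩ hb π
    · exact (hC₀ x (hK₁₂ hx) y (hminK k x hx _ hb) π).trans
        ((le_max_left _ _).trans (le_max_right _ _))
    · have h1 := hb (y, false)
      rw [hPt, hPf] at h1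
      have h2 : α₀ * Ψ x y ≤ α k / 2 * Ψ x y :=
        mul_le_mul_of_nonneg_right (by linarith [hα2 k]) (hΨ0 x y)
      exact (hest (α k) (hαa k) x (hK₁₂ hx) y (hminK k x hx _ hb) (by linarith) π
        (hr x (α k) y (hminK k x hx _ hb) (hminS k x _ hb) π)).trans
        ((le_max_right _ _).trans (le_max_right _ _))
  have hvh : ∀ y x, -(2 * B) ≤ (v y - h₂ x) / (1 + ε) := by
    intro y x
    rw [le_div_iff₀ hε2]
    have := mul_nonneg hε.le hB
    linarith [(abs_le.1 (S.v_le y)).1, (abs_le.1 (S.h₂_le x)).2]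
  -- The compact set of configurations, on which the errors are combined. The right variables are
  -- indexed by all of `ℕ`, so that it does not depend on the weights.
  set Q : Set (E × ProbabilityMeasure F × (ℕ → E × Bool)) :=
    {q | q.1 ∈ K₁ ∧ donskerVaradhan (A q.1) q.2.1 ≤ M ∧
      ∀ k b', W (q.2.2 k).1 + P k q.1 (q.2.2 k) ≤ W b'.1 + P k q.1 b'} with hQ
  have hQc : IsCompact Q := by
    have h1 : IsCompact (K₁ ×ˢ (Set.univ : Set (ProbabilityMeasure F)) ×ˢ
        Set.univ.pi fun _ : ℕ => K₂ ×ˢ (Set.univ : Set Bool)) :=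
      hK₁c.prod (isCompact_univ.prod (isCompact_univ_pi fun _ =>
        hK₂c.prod (Set.finite_univ (α := Bool)).isCompact))
    refine h1.of_isClosed_subset ?_ fun q hq => ⟨hq.1, Set.mem_univ _, fun k _ =>
      ⟨hminK k _ hq.1 _ (hq.2.2 k), Set.mem_univ _⟩⟩
    refine (hK₁c.isClosed.preimage continuous_fst).inter (IsClosed.inter ?_ ?_)
    · exact (S.regI.lsc.comp (g := fun q : E × ProbabilityMeasure F × (ℕ → E × Bool) =>
        (q.1, q.2.1)) (by fun_prop)).isClosed_preimage (M : EReal)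
    · have h3 : ∀ k b', IsClosed {q : E × ProbabilityMeasure F × (ℕ → E × Bool) |
          W (q.2.2 k).1 + P k q.1 (q.2.2 k) ≤ W b'.1 + P k q.1 b'} := by
        intro k b'
        have h2 : LowerSemicontinuous fun q : E × ProbabilityMeasure F × (ℕ → E × Bool) =>
            W (q.2.2 k).1 + (P k q.1 (q.2.2 k) - P k q.1 b') := by
          refine (S.lowerSemicontinuous_perturbedSuper.comp (by fun_prop)).add
            (Continuous.lowerSemicontinuous ?_)
          exact ((hPc k).comp (by fun_prop : Continuous
            fun q : E × ProbabilityMeasure F × (ℕ → E × Bool) => (q.1, q.2.2 k))).sub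
            ((hPc k).comp (by fun_prop : Continuous
              fun q : E × ProbabilityMeasure F × (ℕ → E × Bool) => (q.1, b')))
        convert h2.isClosed_preimage (W b'.1) using 1
        ext q
        simp only [Set.mem_ofPred_eq, Set.mem_preimage, Set.mem_Iic]
        constructor <;> intro h <;> linarith
      have h4 : {q : E × ProbabilityMeasure F × (ℕ → E × Bool) | ∀ k b',
          W (q.2.2 k).1 + P k q.1 (q.2.2 k) ≤ W b'.1 + P k q.1 b'} = ⋂ (k : ℕ) (b' : E × Bool),
          {q | W (q.2.2 k).1 + P k q.1 (q.2.2 k) ≤ W b'.1 + P k q.1 b'} := by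
        ext q
        simp only [Set.mem_iInter, Set.mem_ofPred_eq]
      have h5 := isClosed_iInter fun k => isClosed_iInter fun b' => h3 k b'
      rw [← h4] at h5
      exact h5
  -- the error functions
  set f : ℕ → E × ProbabilityMeasure F × (ℕ → E × Bool) → ℝ := fun k q =>
    errorTerm V A Ψ Υ lam h₂ u v c ε α₀ η M N D₀ (α k) q.1 q.2.1 (q.2.2 k) with hf
  have hfusc : ∀ k, UpperSemicontinuousOn (f k) Q := fun k =>
    ((S.upperSemicontinuous_errorTerm hM0 hN0).comp
      (g := fun q : E × ProbabilityMeasure F × (ℕ → E × Bool) => ((q.1, q.2.1), q.2.2 k))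
      (by fun_prop)).upperSemicontinuousOn Q
  have hImin : ∀ q ∈ Q, ∃ i : ℝ, 0 ≤ i ∧ donskerVaradhan (A q.1) q.2.1 = i ∧
      (min (donskerVaradhan (A q.1) q.2.1) M).toReal = i := by
    intro q hq
    have h1 := hq.2.1
    have h2 := S.regI.nonneg q.1 q.2.1
    have h3 : (((donskerVaradhan (A q.1) q.2.1).toReal : ℝ) : EReal) =
        donskerVaradhan (A q.1) q.2.1 :=
      EReal.coe_toReal (h1.trans_lt (EReal.coe_lt_top _)).ne (EReal.bot_lt_zero.trans_le h2).ne'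
    exact ⟨_, EReal.toReal_nonneg h2, h3.symm, by rw [min_eq_left h1]⟩
  -- the part of the error without the multiplier
  have hfe : ∀ k, ∀ q ∈ Q, f k q ≤ Ce + N * (U q.1 - W (q.2.2 k).1 - P k q.1 (q.2.2 k) - D₀) := by
    intro k q hq
    obtain ⟨i, hi0, hi, hi'⟩ := hImin q hq
    have h1 := mul_le_mul_of_nonneg_left (hLle k q.1 hq.1 _ (hq.2.2 k) q.2.1) hlam.le
    have h2 := hvh (q.2.2 k).1 q.1
    have h3 : 0 ≤ lam * (ε * c) := by positivity
    have h4 : 0 ≤ lam * i := by positivity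
    simp only [hf, errorTerm, hi']
    linarith
  have hD : ∀ k, ∀ q ∈ Q, U q.1 - W (q.2.2 k).1 - P k q.1 (q.2.2 k) - D₀ ≤ η / 2 := by
    intro k q hq
    have h1 := hpenD q.1 (hK₁₂ hq.1) _ (hminK k q.1 hq.1 _ (hq.2.2 k))
    linarith [hPα₀ k q.1 (q.2.2 k)]
  have hfC : ∀ k, ∀ q ∈ Q, f k q ≤ Ce + N * (η / 2) := fun k q hq =>
    (hfe k q hq).trans (add_le_add le_rfl (mul_le_mul_of_nonneg_left (hD k q hq) hN0))
  have hflim : ∀ q ∈ Q, ∀ δ > 0, ∀ᶠ k in atTop, f k q < δ := by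
    intro q hq δ hδ
    by_contra hcon
    have hfreq : ∃ᶠ k in atTop, δ ≤ f k q := by
      simpa only [not_eventually, not_lt] using hcon
    obtain ⟨φ, hφ, hφδ⟩ := extraction_of_frequently_atTop hfreq
    -- On the branch `false` the error is at most `Ce - N * (η / 2) = 0`.
    have hbranch : ∀ n, (q.2.2 (φ n)).2 = true := by
      intro n
      by_contra hb
      rw [Bool.not_eq_true] at hb
      have h1 := hfe (φ n) q hq
      have h2 : P (φ n) q.1 (q.2.2 (φ n)) = α₀ * Ψ q.1 (q.2.2 (φ n)).1 + η := by
        rw [← hPf, ← hb]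
      have h3 := hpenD q.1 (hK₁₂ hq.1) _ (hminK (φ n) q.1 hq.1 _ (hq.2.2 (φ n)))
      have h4 : N * (U q.1 - W (q.2.2 (φ n)).1 - P (φ n) q.1 (q.2.2 (φ n)) - D₀) ≤
          N * (-(η / 2)) := mul_le_mul_of_nonneg_left (by rw [h2]; linarith) hN0
      have h5 : N * (-(η / 2)) = -Ce := by rw [hN]; field_simp
      linarith [hφδ n]
    obtain ⟨i, hi0, hi, hi'⟩ := hImin q hq
    obtain ⟨n, hn⟩ := S.exists_error_lt hK₂c hx₀ hN0 (hK₁₂ hq.1) hi (fun n => hαpos (φ n))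
      (hαtop.comp hφ.tendsto_atTop) (y := fun n => (q.2.2 (φ n)).1)
      (fun n => hminK (φ n) q.1 hq.1 _ (hq.2.2 (φ n)))
      (fun n y' => by
        have := hminS (φ n) q.1 _ (hq.2.2 (φ n)) y'
        rw [hbranch n] at this
        exact this) hδ
    have h1 := hφδ n
    simp only [hf, errorTerm, hi', cappedPenalty, hbranch n, branchSlope, if_true, add_zero] at h1
    exact absurd hn (not_lt.2 h1)
  -- conclusion, for every accuracy
  refine le_of_forall_pos_le_add fun κ hκ => ?_
  obtain ⟨δ, hδ, hδ1, hδκ⟩ : ∃ δ > 0, δ ≤ 1 ∧ δ + lam * δ / (1 - ε) ≤ κ := by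
    refine ⟨min 1 (κ / (1 + lam / (1 - ε))), by positivity, min_le_left _ _, ?_⟩
    have h1 := min_le_right 1 (κ / (1 + lam / (1 - ε)))
    rw [le_div_iff₀ (by positivity)] at h1
    refine le_trans (le_of_eq ?_) h1
    ring
  obtain ⟨s', w, hw0, hw1, hwf⟩ := exists_weights_sum_le hQc f hfusc hfC hflim hδ
  have hsumB : ∀ y : ℕ → E, -B ≤ ∑ k ∈ s', w k * W (y k) := by
    intro y
    calc -B = ∑ k ∈ s', w k * -B := by rw [← Finset.sum_mul, hw1, one_mul]
      _ ≤ _ := Finset.sum_le_sum fun k hk => mul_le_mul_of_nonneg_left (hWB _) (hw0 k hk)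
  obtain ⟨x, hxK, b, hbmin, hxmax, hxD⟩ := exists_max_sub_sum_min
    S.upperSemicontinuous_perturbedSub S.lowerSemicontinuous_perturbedSuper hK₁c hK₂c hPc hP0 hP1
    (x₀ := x₀) hw0 hw1 (fun x y h => hUK x (by linarith [hsumB y])) hWK
  obtain ⟨π, i, hi0, hi, hsub⟩ := S.sub_ineq (x := x) (y := fun k => (b k).1)
    (a := fun k => branchSlope α₀ (α k) (b k).2) hw0 hw1 (fun x' => by
      have h1 := hxmax x'
      have h2 : ∀ z : E, ∑ k ∈ s', w k * (W (b k).1 + P k z (b k)) =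
          ∑ k ∈ s', w k * (W (b k).1 + if (b k).2 then 0 else η) +
            ∑ k ∈ s', w k * (branchSlope α₀ (α k) (b k).2 * Ψ z (b k).1) := fun z => by
        rw [← Finset.sum_add_distrib]
        refine Finset.sum_congr rfl fun k _ => ?_
        simp only [hP, cappedPenalty]
        ring
      rw [h2, h2] at h1
      linarith) hδ
  have hLw : ∑ k ∈ s', w k * leftValue (averagedV V) Ψ (branchSlope α₀ (α k) (b k).2) x (b k).1 π ≤
      CL := by
    calc _ ≤ ∑ k ∈ s', w k * CL := Finset.sum_le_sum fun k hk =>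
          mul_le_mul_of_nonneg_left (hLle k x hxK _ (hbmin k) π) (hw0 k hk)
      _ = CL := by rw [← Finset.sum_mul, hw1, one_mul]
  set Lw := ∑ k ∈ s', w k * leftValue (averagedV V) Ψ (branchSlope α₀ (α k) (b k).2) x (b k).1 π
    with hLwdef
  have hiM : i ≤ M := by
    have h1 : -(2 * B / (1 - ε)) ≤ (u x - h₁ x) / (1 - ε) := by
      rw [← neg_div]
      exact div_le_div_of_nonneg_right
        (by linarith [(abs_le.1 (S.u_le x)).1, (abs_le.1 (S.h₁_le x)).2]) hε1.le
    have h2 : lam * (ε * c + δ) / (1 - ε) ≤ lam * ((ε * c + 1) / (1 - ε)) := by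
      rw [mul_div_assoc]
      gcongr
    have h3 : lam * (2 * B / (1 - ε) / lam) = 2 * B / (1 - ε) := mul_div_cancel₀ _ hlam.ne'
    have h4 : lam * i ≤ lam * M := by
      have h5 := mul_le_mul_of_nonneg_left hLw hlam.le
      rw [hM, mul_add, mul_add, h3]
      linarith
    exact le_of_mul_le_mul_left h4 hlam
  have hq : (x, π, b) ∈ Q := ⟨hxK, by rw [hi]; exact_mod_cast hiM, hbmin⟩
  have hfinal := hwf _ hq
  have hImin' : (min (donskerVaradhan (A x) π) M).toReal = i := by
    rw [hi, min_eq_left (by exact_mod_cast hiM), EReal.toReal_coe]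
  set vw := ∑ k ∈ s', w k * v (b k).1 with hvw
  set Dw := ∑ k ∈ s', w k * (U x - W (b k).1 - P k x (b k) - D₀) with hDw
  have hsplit : ∑ k ∈ s', w k * f k (x, π, b) = lam * Lw - vw / (1 + ε) + N * Dw +
      (-(lam * i) + h₂ x / (1 + ε) - lam * (ε * c)) := by
    have h1 : (-(lam * i) + h₂ x / (1 + ε) - lam * (ε * c)) =
        ∑ k ∈ s', w k * (-(lam * i) + h₂ x / (1 + ε) - lam * (ε * c)) := by
      rw [← Finset.sum_mul, hw1, one_mul]
    rw [h1, hLwdef, hvw, hDw, Finset.mul_sum, Finset.sum_div, Finset.mul_sum,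
      ← Finset.sum_sub_distrib, ← Finset.sum_add_distrib, ← Finset.sum_add_distrib]
    refine Finset.sum_congr rfl fun k _ => ?_
    simp only [hf, errorTerm, hImin', hP]
    ring
  have hDw0 : 0 ≤ Dw := by
    have h1 : Dw = U x - D₀ - ∑ k ∈ s', w k * (W (b k).1 + P k x (b k)) := by
      have h2 : U x - D₀ = ∑ k ∈ s', w k * (U x - D₀) := by
        rw [← Finset.sum_mul, hw1, one_mul]
      rw [h2, hDw, ← Finset.sum_sub_distrib]
      refine Finset.sum_congr rfl fun k _ => ?_
      ring
    rw [h1]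
    linarith
  have hUW : D₀ ≤ u x / (1 - ε) - vw / (1 + ε) := by
    have h1 : vw / (1 + ε) ≤ ∑ k ∈ s', w k * (W (b k).1 + P k x (b k)) := by
      rw [hvw, Finset.sum_div]
      refine Finset.sum_le_sum fun k hk => ?_
      rw [mul_div_assoc]
      refine mul_le_mul_of_nonneg_left ?_ (hw0 k hk)
      refine le_trans ?_ (le_add_of_nonneg_right (hP0 k x (b k)))
      refine div_le_div_of_nonneg_right (le_add_of_nonneg_right ?_) hε2.le
      exact mul_nonneg hε.le (S.containment.nonneg _ (b k).1.2)
    have h2 : U x ≤ u x / (1 - ε) := by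
      refine div_le_div_of_nonneg_right (sub_le_self _ ?_) hε1.le
      exact mul_nonneg hε.le (S.containment.nonneg _ x.2)
    linarith
  -- The multiplier term has the good sign after averaging, and can be dropped.
  have hND : 0 ≤ N * Dw := mul_nonneg hN0 hDw0
  have hh : h₁ x / (1 - ε) - h₂ x / (1 + ε) ≤ s + 2 * B * ε / (1 - ε) := by
    have h1 : h₁ x / (1 - ε) - h₂ x / (1 + ε) =
        (h₁ x - h₂ x) + (h₁ x * ε / (1 - ε) + h₂ x * ε / (1 + ε)) := by
      field_simp
      ring
    have h2 : h₁ x * ε / (1 - ε) ≤ B * ε / (1 - ε) := by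
      gcongr
      exact (abs_le.1 (S.h₁_le x)).2
    have h3 : h₂ x * ε / (1 + ε) ≤ B * ε / (1 - ε) := by
      have h4 : h₂ x * ε / (1 + ε) ≤ B * ε / (1 + ε) := by
        gcongr
        exact (abs_le.1 (S.h₂_le x)).2
      refine h4.trans ?_
      gcongr
      linarith
    rw [h1, show 2 * B * ε / (1 - ε) = B * ε / (1 - ε) + B * ε / (1 - ε) by ring]
    linarith [hs x]
  have hεc : lam * (ε * c) ≤ lam * (ε * c) / (1 - ε) :=
    le_div_self (by positivity) hε1 (by linarith)
  have hlast : lam * (ε * c + δ) / (1 - ε) = lam * (ε * c) / (1 - ε) + lam * δ / (1 - ε) := by ring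
  have hlast' : 2 * lam * (ε * c) / (1 - ε) =
      lam * (ε * c) / (1 - ε) + lam * (ε * c) / (1 - ε) := by ring
  have hsub' : u x / (1 - ε) - h₁ x / (1 - ε) ≤ lam * (Lw - i) + lam * (ε * c + δ) / (1 - ε) := by
    rw [← sub_div]
    exact hsub
  rw [hsplit] at hfinal
  rw [hlast']
  linarith

end DoublingSetting

end SlowFast

/-! ### The comparison principle -/

theorem theorem5p1 {d : ℕ} (E : Set (EuclideanSpace ℝ (Fin d)))
    (hE : E ⊆ closure (interior E))
    {F : Type*} [MetricSpace F] [CompactSpace F] [MeasurableSpace F] [BorelSpace F]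
    (D : Submodule ℝ C(F, ℝ))
    (V : E → EuclideanSpace ℝ (Fin d) → C(F, ℝ))
    (A : E → D →ₗ[ℝ] C(F, ℝ))
    (hA : ∀ g : D, Continuous fun x : E => A x g)
    (hEig : SlowFast.PrincipalEigenvalueAssumption D V A)
    (hV : SlowFast.RegularV E V)
    (hI : SlowFast.RegularI fun (x : E) (π : ProbabilityMeasure F) =>
      SlowFast.donskerVaradhan (A x) π)
    (h₁ h₂ : BoundedContinuousFunction E ℝ) (lam : ℝ) (hlam : 0 < lam)
    (u v : E → ℝ)
    (hu : SlowFast.IsSubsolution (SlowFast.limitHamiltonian E D V A) lam h₁ u)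
    (hv : SlowFast.IsSupersolution (SlowFast.limitHamiltonian E D V A) lam h₂ v) :
    (⨆ x, (u x - v x)) ≤ ⨆ x, (h₁ x - h₂ x) := by
  rcases isEmpty_or_nonempty E with hempty | hne
  -- Over the empty set both suprema are `0` by convention.
  · simp only [Real.iSup_of_isEmpty, le_refl]
  obtain ⟨Υ, hΥ⟩ := hV.containment
  obtain ⟨c, hc⟩ := hΥ.bounded
  obtain ⟨Ψ, hΨ, hest⟩ := hV.continuityEstimate
  obtain ⟨Bu, hBu⟩ := hu.1
  obtain ⟨Bv, hBv⟩ := hv.1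
  set B : ℝ := max (max Bu Bv) (max ‖h₁‖ ‖h₂‖) with hB
  have hbdd : BddAbove (Set.range fun x => h₁ x - h₂ x) := by
    refine ⟨‖h₁‖ + ‖h₂‖, ?_⟩
    rintro _ ⟨x, rfl⟩
    have h3 := (abs_le.1 (h₁.norm_coe_le_norm x)).2
    have h4 := (abs_le.1 (h₂.norm_coe_le_norm x)).1
    simp only
    linarith
  have hset : ∀ ε : ℝ, 0 < ε → ε < 1 →
      SlowFast.DoublingSetting E D V A Ψ Υ lam h₁ h₂ u v B (max c 0) ε := fun ε hε0 hε1 =>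
    { eig := hEig
      regV := hV
      contA := hA
      regI := hI
      pen := hΨ
      estimate := hest
      containment := hΥ
      V_le := fun x z => (hc x z).trans (le_max_left _ _)
      c_nonneg := le_max_right _ _
      lam_pos := hlam
      cont_h₁ := h₁.continuous
      cont_h₂ := h₂.continuous
      sub := hu
      super := hv
      h₁_le := fun x => (h₁.norm_coe_le_norm x).trans ((le_max_left _ _).trans (le_max_right _ _))
      h₂_le := fun x => (h₂.norm_coe_le_norm x).trans ((le_max_right _ _).trans (le_max_right _ _))
      u_le := fun x => (hBu x).trans ((le_max_left _ _).trans (le_max_left _ _))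
      v_le := fun x => (hBv x).trans ((le_max_right _ _).trans (le_max_left _ _))
      eps_pos := hε0
      eps_lt := hε1 }
  set s : ℝ := ⨆ x, (h₁ x - h₂ x) with hs
  refine ciSup_le fun x => ?_
  have hε : ∀ ε ∈ Set.Ioo (0 : ℝ) 1,
      SlowFast.perturbedSub Υ ε u x - SlowFast.perturbedSuper Υ ε v x ≤
        s + 2 * B * ε / (1 - ε) + 2 * lam * (ε * max c 0) / (1 - ε) := by
    intro ε hε
    obtain ⟨x₀, hx₀⟩ := (hset ε hε.1 hε.2).exists_max
    exact (hx₀ x).trans ((hset ε hε.1 hε.2).perturbed_sub_le (fun y => le_ciSup hbdd y) hx₀)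
  have hcl : ContinuousAt (fun ε : ℝ => SlowFast.perturbedSub Υ ε u x -
      SlowFast.perturbedSuper Υ ε v x) 0 := by
    unfold SlowFast.perturbedSub SlowFast.perturbedSuper
    exact (ContinuousAt.div (by fun_prop) (by fun_prop) (by norm_num)).sub
      (ContinuousAt.div (by fun_prop) (by fun_prop) (by norm_num))
  have hcr : ContinuousAt (fun ε : ℝ =>
      s + 2 * B * ε / (1 - ε) + 2 * lam * (ε * max c 0) / (1 - ε)) 0 :=
    (continuousAt_const.add (ContinuousAt.div (by fun_prop) (by fun_prop) (by norm_num))).add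
      (ContinuousAt.div (by fun_prop) (by fun_prop) (by norm_num))
  have hlim := le_of_tendsto_of_tendsto
    (hcl.tendsto.mono_left (nhdsWithin_le_nhds (s := Set.Ioi 0)))
    (hcr.tendsto.mono_left nhdsWithin_le_nhds)
    (by filter_upwards [Ioo_mem_nhdsGT (zero_lt_one' ℝ)] with ε h using hε ε h)
  simpa [SlowFast.perturbedSub, SlowFast.perturbedSuper] using hlim
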